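/- Let $g\ge 0$ and $-1<\alpha_1<\beta_1<\alpha_2<\beta_2<\dots<\alpha_g<\beta_g<1$, let $$E=[-1,\alpha_1]\cup[\beta_1,\alpha_2]\cup\dots\cup[\beta_g,1],\qquad w(x)=\frac1\pi\sqrt{\frac{\prod_{j=1}^g(x-\alpha_j)}{(1-x^2)\prod_{j=1}^g(x-\beta_j)}}\quad(x\in E),$$ let $P_n$ be the monic orthogonal polynomials of $w$ on $E$, $h_n=\int_E P_n^2\,w\,dx$, let $Q_n(z)=\int_E\frac{P_n(z)-P_n(t)}{z-t}\,w(t)\,dt$ be the polynomials of the second kind, and let $a_n,b_n$ be the coefficients of the recurrence $xP_n=P_{n+1}+b_{n+1}P_n+a_nP_{n-1}$. Let $\mathfrak K\ge 1$ be an integer such that the recurrence coefficients have period $\mathfrak K$, that is, $b_{n+\mathfrak K}=b_n$ for $n\ge1$ and $a_{n+\mathfrak K}=a_n$ for $n\ge2$. Put $\Delta_{\mathfrak K}=\sqrt{2h_{\mathfrak K}}$. Then $g\le\mathfrak K-1$, and one can insert $\mathfrak K-1-g$ closed gaps (pairs of equal points $\alpha_j=\beta_j$ in the interior of $E$) into the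 list of gaps so that, after renumbering, $-1<\alpha_1\le\beta_1<\alpha_2\le\dots\le\beta_{\mathfrak K-1}<1$, the set $E$ is the union of the $\mathfrak K$ subintervals $E_1=[-1,\alpha_1],\,E_2=[\beta_1,\alpha_2],\dots,E_{\mathfrak K}=[\beta_{\mathfrak K-1},1]$, and $P_{\mathfrak K}/\Delta_{\mathfrak K}$ maps each $E_i$ bijectively onto $[-1,1]$ (if $g=\mathfrak K-1$, nothing is inserted). Moreover: 1. For every $n\ge0$, $P_{n\mathfrak K}=\Delta_{\mathfrak K}^n\,T_n(P_{\mathfrak K}/\Delta_{\mathfrak K})$, where $T_n$ is the monic Chebyshev polynomial of the first kind; all complex zeros of $P_{n\mathfrak K}$ are simple and lie in $E$; and each $E_i$ contains exactly $n$ of them, all in the interior of $E_i$. 2. For every $n\ge1$, $Q_{n\mathfrak K}$ vanishes at $\alpha_1,\dots,\alpha_{\mathfrak K-1}$; all its other complex zeros lie in the interiors of the $E_i$; the interior of each $E_i$ contains exactly $n-1$ of them; and these interlace with the $n$ zeros of $P_{n\mathfrak K}$ in $E_i$. -/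

import Mathlib

open Polynomial

noncomputable section

namespace GenCheb

/-- Left end points of the `g + 1` subintervals: `-1, β₁, …, β_g`. -/
def bandLeft {g : ℕ} (β : Fin g → ℝ) (i : Fin (g + 1)) : ℝ :=
  Fin.cons (α := fun _ => ℝ) (-1) β i

/-- Right end points of the `g + 1` subintervals: `α₁, …, α_g, 1`. -/
def bandRight {g : ℕ} (α : Fin g → ℝ) (i : Fin (g + 1)) : ℝ :=
  Fin.snoc (α := fun _ => ℝ) α 1 i

/-- The closed subintervals `[-1, α₁], [β₁, α₂], …, [β_g, 1]`. -/
def band {g : ℕ} (α β : Fin g → ℝ) (i : Fin (g + 1)) : Set ℝ :=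
  Set.Icc (bandLeft β i) (bandRight α i)

/-- `E = [-1, α₁] ∪ [β₁, α₂] ∪ ⋯ ∪ [β_g, 1]`. -/
def bandSet {g : ℕ} (α β : Fin g → ℝ) : Set ℝ :=
  ⋃ i, band α β i

/-- `-1 < α₁ ≤ β₁ < α₂ ≤ β₂ < ⋯ ≤ β_g < 1`: the subintervals are nondegenerate, the gaps
`(α_j, β_j)` may be closed. -/
def Ordered {g : ℕ} (α β : Fin g → ℝ) : Prop :=
  (∀ i, bandLeft β i < bandRight α i) ∧ ∀ j, α j ≤ β j

/-- `-1 < α₁ < β₁ < α₂ < ⋯ < β_g < 1`: as `Ordered`, with all gaps open. -/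
def StrictlyOrdered {g : ℕ} (α β : Fin g → ℝ) : Prop :=
  (∀ i, bandLeft β i < bandRight α i) ∧ ∀ j, α j < β j

/-- The weight `w(x) = (1/π) √(∏(x - α_j) / ((1 - x²) ∏(x - β_j)))`. -/
def weight {g : ℕ} (α β : Fin g → ℝ) (x : ℝ) : ℝ :=
  1 / Real.pi * Real.sqrt ((∏ j, (x - α j)) / ((1 - x ^ 2) * ∏ j, (x - β j)))

/-- `⟨p, q⟩ = ∫_E p(x) q(x) w(x) dx`. -/
def ip {g : ℕ} (α β : Fin g → ℝ) (p q : ℝ[X]) : ℝ :=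
  ∫ x in bandSet α β, p.eval x * q.eval x * weight α β x

/-- The monic orthogonal polynomials `P_n` of the weight `w` on `E`, by the Gram–Schmidt process
applied to `1, x, x², …`. -/
def P {g : ℕ} (α β : Fin g → ℝ) (n : ℕ) : ℝ[X] :=
  X ^ n - ∑ k : Fin n, C (ip α β (X ^ n) (P α β k) / ip α β (P α β k) (P α β k)) * P α β k
termination_by n
decreasing_by exact k.2

/-- `h_n = ∫_E P_n² w`. -/
def h {g : ℕ} (α β : Fin g → ℝ) (n : ℕ) : ℝ :=
  ip α β (P α β n) (P α β n)

/-- The polynomial of the second kind, as a function on `ℂ`: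
`Q_n(z) = ∫_E (P_n(z) - P_n(t)) / (z - t) w(t) dt`. -/
def Q {g : ℕ} (α β : Fin g → ℝ) (n : ℕ) (z : ℂ) : ℂ :=
  ∫ t in bandSet α β,
    (aeval z (P α β n) - (((P α β n).eval t : ℝ) : ℂ)) / (z - (t : ℂ)) * (weight α β t : ℂ)

/-- The coefficient `a_n` (`n ≥ 1`) of `x P_n = P_{n+1} + b_{n+1} P_n + a_n P_{n-1}`. -/
def recA {g : ℕ} (α β : Fin g → ℝ) (n : ℕ) : ℝ :=
  h α β n / h α β (n - 1)

/-- The coefficient `b_n` (`n ≥ 1`) of `x P_{n-1} = P_n + b_n P_{n-1} + a_{n-1} P_{n-2}`. -/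
def recB {g : ℕ} (α β : Fin g → ℝ) (n : ℕ) : ℝ :=
  ip α β (X * P α β (n - 1)) (P α β (n - 1)) / h α β (n - 1)

/-- The recurrence coefficients have period `K`: `b_{n+K} = b_n` for `n ≥ 1` and
`a_{n+K} = a_n` for `n ≥ 2`. -/
def HasPeriod {g : ℕ} (α β : Fin g → ℝ) (K : ℕ) : Prop :=
  (∀ n, 1 ≤ n → recB α β (n + K) = recB α β n) ∧
    ∀ n, 2 ≤ n → recA α β (n + K) = recA α β n

/-- `Δ_K = √(2 h_K)`. -/
def Δ {g : ℕ} (α β : Fin g → ℝ) (K : ℕ) : ℝ :=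
  Real.sqrt (2 * h α β K)

/-- The monic Chebyshev polynomial of the first kind of degree `n`. -/
def monicT (n : ℕ) : ℝ[X] :=
  C ((2 : ℝ) ^ (n - 1))⁻¹ * Chebyshev.T ℝ n

/-- The end points `α', β'` arise from `α, β` by inserting closed gaps `α'_k = β'_k`. -/
def InsertsClosedGaps {g m : ℕ} (α β : Fin g → ℝ) (α' β' : Fin m → ℝ) : Prop :=
  Ordered α' β' ∧ bandSet α' β' = bandSet α β ∧
    ∃ ι : Fin g → Fin m, StrictMono ι ∧ (∀ j, α' (ι j) = α j ∧ β' (ι j) = β j) ∧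
      ∀ k, k ∉ Set.range ι → α' k = β' k

/-- Between two points of either set lies a point of the other one. -/
def Interlace (A B : Set ℝ) : Prop :=
  (∀ x ∈ A, ∀ x' ∈ A, x < x' → ∃ y ∈ B, x < y ∧ y < x') ∧
    ∀ y ∈ B, ∀ y' ∈ B, y < y' → ∃ x ∈ A, y < x ∧ x < y'

end GenCheb

end

open GenCheb

/-! Write N = ∏(x - α_j), D = (x² - 1)∏(x - β_j), and let ψ_n(x) = ∫ P_n(t) w(t)/(x - t) dt for x >
1 (`psi`), so that ψ_n = P_n ψ_0 - Q_n (`psi_eq`). Two facts about ψ_n carry the proof.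

First, ψ_0 is algebraic: ψ_0² = N/D (`Ordered.psi_zero_sq`). On E the boundary value of √(N/D) from
the upper half-plane is -iπw, elsewhere on the line it is real, and Cauchy's theorem identifies it
with the Stieltjes transform of w (`Ordered.rootFun_eq_psi_zero`).

Second, ψ_n is the decaying solution of the three-term recurrence: it is O(√h_n x⁻ⁿ) (`abs_psi_le`).
Under periodicity ψ_{n+K} solves the same recurrence and decays too, so the Casoratian of the two
vanishes (`HasPeriod.psi_rel`). Substituting ψ_n = P_n ψ_0 - Q_n gives a quadratic equation for ψ_0
with polynomial coefficients. Since N D is not a square, its part odd in ψ_0 and its part even in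
ψ_0 vanish separately. This yields Q_K = N S, a_1 = 2a_{K+1}, h_0 = 1 and the Pell equation P_K² =
Δ_K² + D N S² (`HasPeriod.exists_pellData`).

Put p = P_K/Δ_K. A shift by one period acts linearly on the pair (P_n, Q_n) (`PellData.shift`), and
the Pell equation turns its iterates into the Chebyshev addition formulas: P_{nK} is a multiple of
T_n(p), and Q_{nK} one of Q_K U_{n-1}(p) (`PellData.chebyshev`).

For the geometry, |p| ≥ 1 wherever D N ≥ 0, in particular on every gap. As P_K has K simple real
zeros, p has exactly K - 1 critical points. Each gap contains one of them, and the others are the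
zeros of S; the latter become the closed gaps. Between consecutive gaps p is injective with end
values ±1 (`PellData.exists_gaps`). All claims on zeros are then those for T_n and U_{n-1}, pulled
back along p on each band. -/

namespace GenCheb

/-! ### Order of the end points -/

section Bands

variable {g : ℕ} {α β : Fin g → ℝ}

@[simp] lemma bandLeft_zero : bandLeft β 0 = -1 := rfl

@[simp] lemma bandLeft_succ (j : Fin g) : bandLeft β j.succ = β j := rfl

@[simp] lemma bandRight_last : bandRight α (Fin.last g) = 1 := by simp [bandRight]

@[simp] lemma bandRight_castSucc (j : Fin g) : bandRight α j.castSucc = α j := by simp [bandRight]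

lemma StrictlyOrdered.ordered (ho : StrictlyOrdered α β) : Ordered α β :=
  ⟨ho.1, fun j => (ho.2 j).le⟩

lemma Ordered.left_lt (ho : Ordered α β) (j : Fin g) : bandLeft β j.castSucc < α j := by
  simpa using ho.1 j.castSucc

lemma Ordered.lt_right (ho : Ordered α β) (j : Fin g) : β j < bandRight α j.succ := by
  simpa using ho.1 j.succ

lemma Ordered.strictMono_left (ho : Ordered α β) : StrictMono (bandLeft β) :=
  Fin.strictMono_iff_lt_succ.2 fun j => (ho.left_lt j).trans_le (ho.2 j)

lemma Ordered.strictMono_right (ho : Ordered α β) : StrictMono (bandRight α) :=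
  Fin.strictMono_iff_lt_succ.2 fun j => by
    simpa using (ho.2 j).trans_lt (ho.lt_right j)

lemma Ordered.strictMono_β (ho : Ordered α β) : StrictMono β := fun i j hij => by
  simpa using ho.strictMono_left (Fin.succ_lt_succ_iff.2 hij)

lemma Ordered.neg_one_lt_α (ho : Ordered α β) (j : Fin g) : -1 < α j :=
  ((ho.strictMono_left.monotone (Fin.zero_le j.castSucc)).trans_lt (ho.left_lt j))

lemma Ordered.β_lt_one (ho : Ordered α β) (j : Fin g) : β j < 1 := by
  simpa using (ho.lt_right j).trans_le (ho.strictMono_right.monotone (Fin.le_last j.succ))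

lemma Ordered.α_lt_one (ho : Ordered α β) (j : Fin g) : α j < 1 :=
  (ho.2 j).trans_lt (ho.β_lt_one j)

lemma Ordered.neg_one_lt_β (ho : Ordered α β) (j : Fin g) : -1 < β j :=
  (ho.neg_one_lt_α j).trans_le (ho.2 j)

lemma Ordered.β_lt_α (ho : Ordered α β) {i j : Fin g} (hij : i < j) : β i < α j :=
  (ho.lt_right i).trans_le <| by
    simpa using ho.strictMono_right.monotone (show i.succ ≤ j.castSucc from hij)

/-- A point of a band lies on one side of every gap. -/
lemma Ordered.le_or_ge_of_mem_band (ho : Ordered α β) {i : Fin (g + 1)} {x : ℝ}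
    (hx : x ∈ band α β i) (j : Fin g) : x ≤ α j ∨ β j ≤ x := by
  rcases le_or_gt i j.castSucc with h | h
  · left
    simpa using hx.2.trans (ho.strictMono_right.monotone h)
  · right
    have h' : j.succ ≤ i := h
    simpa using (ho.strictMono_left.monotone h').trans hx.1

/-- Membership becomes one condition per gap, and a closed gap satisfies its condition
automatically. Hence inserting closed gaps visibly leaves the set unchanged. -/
lemma Ordered.bandSet_eq (ho : Ordered α β) :
    bandSet α β = {x | x ∈ Set.Icc (-1) 1 ∧ ∀ j, x ≤ α j ∨ β j ≤ x} := by
  ext x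
  simp only [bandSet, Set.mem_iUnion, Set.mem_ofPred_eq]
  constructor
  · rintro ⟨i, hi⟩
    refine ⟨⟨?_, ?_⟩, ho.le_or_ge_of_mem_band hi⟩
    · exact (ho.strictMono_left.monotone (Fin.zero_le i)).trans hi.1
    · simpa using hi.2.trans (ho.strictMono_right.monotone (Fin.le_last i))
  · rintro ⟨hx, hj⟩
    -- The band sought is the last one that starts at or before x.
    let s : Finset (Fin (g + 1)) := Finset.univ.filter fun i => bandLeft β i ≤ x
    have hs : s.Nonempty := ⟨0, by simpa [s] using hx.1⟩
    have hi : bandLeft β (s.max' hs) ≤ x := by simpa [s] using s.max'_mem hs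
    refine ⟨s.max' hs, hi, ?_⟩
    rcases Fin.eq_castSucc_or_eq_last (s.max' hs) with ⟨j, hj'⟩ | h
    · rw [hj']
      rcases hj j with h | h
      · simpa using h
      · exfalso
        have h2 : j.succ ∈ s := by simpa [s] using h
        have h3 := s.le_max' _ h2
        rw [hj'] at h3
        exact absurd h3 (not_le.2 (Fin.castSucc_lt_succ))
    · rw [h]; simpa using hx.2

lemma Ordered.bandSet_subset (ho : Ordered α β) : bandSet α β ⊆ Set.Icc (-1) 1 := by
  rw [ho.bandSet_eq]; exact fun x hx => hx.1

lemma isCompact_bandSet : IsCompact (bandSet α β) := isCompact_iUnion fun _ => isCompact_Icc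

lemma measurableSet_bandSet : MeasurableSet (bandSet α β) := isCompact_bandSet.measurableSet

end Bands

/-! ### Products of inverse square roots -/

section Integrability

open MeasureTheory

lemma intervalIntegrable_inv_sqrt_abs (c : ℝ) :
    IntervalIntegrable (fun x : ℝ => (√|x|)⁻¹) volume 0 c := by
  have key : ∀ c : ℝ, 0 ≤ c → IntervalIntegrable (fun x : ℝ => (√|x|)⁻¹) volume 0 c := by
    intro c hc
    refine (intervalIntegral.intervalIntegrable_rpow' (r := -(1/2)) (by norm_num)).congr ?_
    intro x hx
    rw [Set.uIoc_of_le hc] at hx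
    simp only
    rw [abs_of_pos hx.1, Real.rpow_neg hx.1.le, Real.sqrt_eq_rpow]
  rcases le_total 0 c with hc | hc
  · exact key c hc
  · have := (key (-c) (by linarith)).comp_mul_left (c := -1)
    simpa using this

lemma intervalIntegrable_inv_sqrt_abs_sub (b c d : ℝ) :
    IntervalIntegrable (fun x : ℝ => (√|x - b|)⁻¹) volume c d := by
  have h := (intervalIntegrable_inv_sqrt_abs (c - b)).symm.trans
    (intervalIntegrable_inv_sqrt_abs (d - b))
  simpa using h.comp_sub_right b

/-- This is √|b - c| ≤ √|x - b| + √|x - c| multiplied by the two inverses. At x = b or x = c the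
left side is 0 because 0⁻¹ = 0. -/
lemma inv_sqrt_mul_inv_sqrt_le {b c : ℝ} (hbc : b ≠ c) (x : ℝ) :
    (√|x - b|)⁻¹ * (√|x - c|)⁻¹ ≤ (√|b - c|)⁻¹ * ((√|x - b|)⁻¹ + (√|x - c|)⁻¹) := by
  have hd : 0 < √|b - c| := Real.sqrt_pos.2 (abs_pos.2 (sub_ne_zero.2 hbc))
  rcases (Real.sqrt_nonneg |x - b|).eq_or_lt with hu | hu
  · rw [← hu]; simp; positivity
  rcases (Real.sqrt_nonneg |x - c|).eq_or_lt with hv | hv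
  · rw [← hv]; simp; positivity
  have h1 : √|b - c| ≤ √|x - b| + √|x - c| := by
    refine (Real.sqrt_le_left (by positivity)).2 ?_
    have h3 : |b - c| ≤ |x - b| + |x - c| := by
      rw [abs_sub_comm x b]; exact abs_sub_le b x c
    have h4 := Real.sq_sqrt (abs_nonneg (x - b))
    have h5 := Real.sq_sqrt (abs_nonneg (x - c))
    nlinarith [mul_pos hu hv]
  field_simp
  linarith

/-- Singularities at distinct points do not compound, so a sum of integrable functions dominates the
product. This substitutes for a partial fraction expansion. -/
lemma prod_inv_sqrt_le (s : Finset ℝ) (hs : s.Nonempty) :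
    ∃ C, 0 ≤ C ∧ ∀ x : ℝ, ∏ b ∈ s, (√|x - b|)⁻¹ ≤ C * ∑ b ∈ s, (√|x - b|)⁻¹ := by
  induction hs using Finset.Nonempty.cons_induction with
  | singleton a => exact ⟨1, zero_le_one, fun x => by simp⟩
  | cons a s ha hs ih =>
    obtain ⟨C, hC, h⟩ := ih
    have hdd : 0 ≤ ∑ b ∈ s, (√|a - b|)⁻¹ := Finset.sum_nonneg fun _ _ => by positivity
    refine ⟨C * (∑ b ∈ s, (√|a - b|)⁻¹), by positivity, fun x => ?_⟩
    rw [Finset.prod_cons, Finset.sum_cons]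
    calc (√|x - a|)⁻¹ * ∏ b ∈ s, (√|x - b|)⁻¹
        ≤ (√|x - a|)⁻¹ * (C * ∑ b ∈ s, (√|x - b|)⁻¹) := by gcongr; exact h x
      _ = C * ∑ b ∈ s, (√|x - a|)⁻¹ * (√|x - b|)⁻¹ := by
          rw [Finset.mul_sum, Finset.mul_sum, Finset.mul_sum]
          exact Finset.sum_congr rfl fun _ _ => by ring
      _ ≤ C * ∑ b ∈ s, (√|a - b|)⁻¹ * ((√|x - a|)⁻¹ + ∑ b ∈ s, (√|x - b|)⁻¹) := by
          refine mul_le_mul_of_nonneg_left (Finset.sum_le_sum fun b hb => ?_) hC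
          refine (inv_sqrt_mul_inv_sqrt_le (ne_of_mem_of_not_mem hb ha).symm x).trans ?_
          gcongr
          exact Finset.single_le_sum (f := fun b => (√|x - b|)⁻¹)
            (fun _ _ => by positivity) hb
      _ = _ := by rw [← Finset.sum_mul, mul_assoc]

lemma measurable_prod_inv_sqrt (s : Finset ℝ) :
    Measurable fun x : ℝ => ∏ b ∈ s, (√|x - b|)⁻¹ :=
  Finset.measurable_fun_prod _ fun b _ => by fun_prop

lemma intervalIntegrable_prod_inv_sqrt (s : Finset ℝ) (c d : ℝ) :
    IntervalIntegrable (fun x : ℝ => ∏ b ∈ s, (√|x - b|)⁻¹) volume c d := by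
  rcases s.eq_empty_or_nonempty with rfl | hs
  · simp
  obtain ⟨C, hC, h⟩ := prod_inv_sqrt_le s hs
  have h1 : IntervalIntegrable (fun x : ℝ => C * ∑ b ∈ s, (√|x - b|)⁻¹) volume c d := by
    refine IntervalIntegrable.const_mul ?_ C
    have := IntervalIntegrable.sum (μ := volume) (a := c) (b := d) s
      (f := fun b x => (√|x - b|)⁻¹) fun b _ => intervalIntegrable_inv_sqrt_abs_sub b c d
    simpa [Finset.sum_fn] using this
  refine h1.mono_fun (measurable_prod_inv_sqrt s).aestronglyMeasurable ?_
  refine Filter.Eventually.of_forall fun x => ?_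
  beta_reduce
  rw [Real.norm_of_nonneg (Finset.prod_nonneg fun _ _ => by positivity)]
  exact (h x).trans (le_abs_self _)

end Integrability

/-! ### Integrability and positivity of the weight -/

section Weight

open MeasureTheory

variable {g : ℕ} {α β : Fin g → ℝ}

/-- The points at which the weight is singular. -/
noncomputable def singSet (β : Fin g → ℝ) : Finset ℝ := insert 1 (insert (-1) (Finset.univ.image β))

lemma Ordered.prod_singSet (ho : Ordered α β) {M : Type*} [CommMonoid M] (f : ℝ → M) :
    ∏ b ∈ singSet β, f b = f 1 * (f (-1) * ∏ j, f (β j)) := by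
  classical
  rw [singSet, Finset.prod_insert, Finset.prod_insert, Finset.prod_image]
  · exact fun i _ j _ h => ho.strictMono_β.injective h
  · simp only [Finset.mem_image, Finset.mem_univ, true_and, not_exists]
    exact fun j h => absurd h (ho.neg_one_lt_β j).ne'
  · simp only [Finset.mem_insert, Finset.mem_image, Finset.mem_univ, true_and, not_or, not_exists]
    exact ⟨by norm_num, fun j h => absurd h (ho.β_lt_one j).ne⟩

lemma weight_nonneg (x : ℝ) : 0 ≤ weight α β x := by unfold weight; positivity

lemma measurable_weight : Measurable (weight α β) := by
  unfold weight
  refine Measurable.const_mul ?_ _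
  refine Measurable.sqrt ?_
  refine Measurable.div ?_ (Measurable.mul (by fun_prop) ?_) <;>
  exact Finset.measurable_fun_prod _ fun b _ => by fun_prop

lemma sqrt_abs_prod {ι : Type*} (s : Finset ι) (f : ι → ℝ) :
    √|∏ i ∈ s, f i| = ∏ i ∈ s, √|f i| := by
  rw [Finset.abs_prod, Real.sqrt_prod _ fun _ _ => abs_nonneg _]

/-- An absolute value under the root only enlarges it, so the bound holds on the whole line. The
numerator is continuous, which leaves a product of inverse square roots to integrate. -/
lemma Ordered.weight_le (ho : Ordered α β) (x : ℝ) :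
    weight α β x ≤ 1 / Real.pi * √|∏ j, (x - α j)| * ∏ b ∈ singSet β, (√|x - b|)⁻¹ := by
  unfold weight
  rw [mul_assoc]
  gcongr
  refine (Real.sqrt_le_sqrt (le_abs_self _)).trans_eq ?_
  rw [ho.prod_singSet, abs_div, Real.sqrt_div (abs_nonneg _), abs_mul, Real.sqrt_mul (abs_nonneg _),
    sqrt_abs_prod _ fun j => x - β j, Finset.prod_inv_distrib,
    show 1 - x ^ 2 = -((x - 1) * (x - -1)) by ring, abs_neg, abs_mul, Real.sqrt_mul (abs_nonneg _)]
  field_simp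

lemma Ordered.integrableOn_weight (ho : Ordered α β) :
    IntegrableOn (weight α β) (bandSet α β) := by
  have h1 : IntegrableOn (fun x => 1 / Real.pi * √|∏ j, (x - α j)| *
      ∏ b ∈ singSet β, (√|x - b|)⁻¹) (Set.Icc (-1) 1) := by
    refine IntegrableOn.continuousOn_mul ?_ ?_ isCompact_Icc
    · refine Continuous.continuousOn ?_
      have : Continuous fun x : ℝ => ∏ j, (x - α j) :=
        continuous_finsetProd _ fun _ _ => by fun_prop
      fun_prop
    · have := intervalIntegrable_prod_inv_sqrt (singSet β) (-1) 1
      rwa [intervalIntegrable_iff_integrableOn_Icc_of_le (by norm_num)] at this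
  refine Integrable.mono' (h1.mono_set ho.bandSet_subset)
    measurable_weight.aestronglyMeasurable ?_
  refine Filter.Eventually.of_forall fun x => ?_
  rw [Real.norm_of_nonneg (weight_nonneg x)]
  exact ho.weight_le x

lemma Ordered.integrableOn_mul_weight (ho : Ordered α β) {f : ℝ → ℝ}
    (hf : ContinuousOn f (bandSet α β)) :
    IntegrableOn (fun x => f x * weight α β x) (bandSet α β) :=
  ho.integrableOn_weight.continuousOn_mul hf isCompact_bandSet

lemma StrictlyOrdered.weight_pos (ho : StrictlyOrdered α β) {x : ℝ} (hx : x ∈ bandSet α β)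
    (hα : ∀ j, x ≠ α j) (hβ : ∀ j, x ≠ β j) (h1 : x ≠ 1) (h2 : x ≠ -1) : 0 < weight α β x := by
  have := ho.ordered.bandSet_eq ▸ hx
  obtain ⟨hx1, hx2⟩ := this
  unfold weight
  refine mul_pos (by positivity) (Real.sqrt_pos.2 ?_)
  rw [mul_comm, ← div_div, ← Finset.prod_div_distrib]
  refine div_pos (Finset.prod_pos fun j _ => ?_) ?_
  · rcases hx2 j with h | h
    · have h3 : x < α j := lt_of_le_of_ne h (hα j)
      have h4 := ho.2 j
      exact div_pos_of_neg_of_neg (by linarith) (by linarith)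
    · have h3 : β j < x := lt_of_le_of_ne h (hβ j).symm
      have h4 := ho.2 j
      exact div_pos (by linarith) (by linarith)
  · have h3 : x < 1 := lt_of_le_of_ne hx1.2 h1
    have h4 : -1 < x := lt_of_le_of_ne hx1.1 h2.symm
    nlinarith

end Weight

/-! ### Orthogonal polynomials: recurrence and real simple zeros -/

section Orthogonal

open MeasureTheory

lemma degree_C_mul_le (c : ℝ) (p : ℝ[X]) : (C c * p).degree ≤ p.degree := by
  rw [← smul_eq_C_mul]; exact degree_smul_le _ _

variable {g : ℕ} {α β : Fin g → ℝ}

/-- The functional `p ↦ ∫_E p w`. -/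
noncomputable def functional (ho : Ordered α β) : ℝ[X] →ₗ[ℝ] ℝ where
  toFun p := ∫ x in bandSet α β, p.eval x * weight α β x
  map_add' p q := by
    rw [← integral_add (ho.integrableOn_mul_weight p.continuous.continuousOn)
      (ho.integrableOn_mul_weight q.continuous.continuousOn)]
    simp only [eval_add, add_mul]
  map_smul' c p := by
    rw [RingHom.id_apply, smul_eq_mul, ← integral_const_mul]
    simp only [eval_smul, smul_eq_mul, mul_assoc]

lemma functional_apply (ho : Ordered α β) (p : ℝ[X]) :
    functional ho p = ∫ x in bandSet α β, p.eval x * weight α β x := rfl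

lemma ip_eq (ho : Ordered α β) (p q : ℝ[X]) : ip α β p q = functional ho (p * q) := by
  simp [ip, functional_apply, eval_mul]

lemma functional_C_mul (ho : Ordered α β) (c : ℝ) (p : ℝ[X]) :
    functional ho (C c * p) = c * functional ho p := by
  rw [← smul_eq_C_mul, map_smul, smul_eq_mul]

lemma functional_nonneg (ho : Ordered α β) {p : ℝ[X]} (hp : ∀ x, 0 ≤ p.eval x) :
    0 ≤ functional ho p :=
  setIntegral_nonneg measurableSet_bandSet fun x _ => mul_nonneg (hp x) (weight_nonneg x)

/-- A nonzero polynomial that is nonnegative has a positive integral. -/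
lemma functional_pos (ho : StrictlyOrdered α β) {p : ℝ[X]} (hp : ∀ x, 0 ≤ p.eval x)
    (h0 : p ≠ 0) : 0 < functional ho.ordered p := by
  refine (functional_nonneg ho.ordered hp).lt_of_ne fun h => ?_
  rw [functional_apply, eq_comm, setIntegral_eq_zero_iff_of_nonneg_ae
    (Filter.Eventually.of_forall fun x => mul_nonneg (hp x) (weight_nonneg x))
    (ho.ordered.integrableOn_mul_weight p.continuous.continuousOn),
    Filter.EventuallyEq, ae_restrict_iff' measurableSet_bandSet] at h
  -- Off this finite set p w is nonzero on E, so a vanishing integral would make E, and with it the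
  -- first band, a null set.
  let s : Set ℝ := {x | p.IsRoot x} ∪ (Set.range α ∪ Set.range β ∪ {1, -1})
  have hs : s.Finite := (finite_setOfPred_isRoot h0).union
    (((Set.finite_range α).union (Set.finite_range β)).union (by simp))
  have h2 : volume (bandSet α β) = 0 := by
    refine measure_mono_null ?_ (measure_union_null (ae_iff.1 h) (hs.measure_zero volume))
    intro x hx
    by_cases hxs : x ∈ s
    · exact Or.inr hxs
    · refine Or.inl fun hx' => ?_
      simp only [s, Set.mem_union, not_or, Set.mem_range, not_exists, Set.mem_insert_iff,
        Set.mem_singleton_iff] at hxs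
      have hw := ho.weight_pos hx (fun j h => hxs.2.1.1 j h.symm) (fun j h => hxs.2.1.2 j h.symm)
        hxs.2.2.1 hxs.2.2.2
      have := hx' hx
      simp only [Pi.zero_apply, mul_eq_zero] at this
      rcases this with h | h
      · exact hxs.1 h
      · exact hw.ne' h
  have h3 : volume (band α β 0) = 0 := measure_mono_null (Set.subset_iUnion _ 0) h2
  rw [band, Real.volume_Icc, ENNReal.ofReal_eq_zero] at h3
  linarith [ho.1 0]

lemma functional_mul_self_pos (ho : StrictlyOrdered α β) {p : ℝ[X]} (h0 : p ≠ 0) :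
    0 < functional ho.ordered (p * p) :=
  functional_pos ho (fun x => by rw [eval_mul]; exact mul_self_nonneg _) (mul_ne_zero h0 h0)

lemma P_eq (n : ℕ) : P α β n = X ^ n - ∑ k ∈ Finset.range n,
    C (ip α β (X ^ n) (P α β k) / ip α β (P α β k) (P α β k)) * P α β k := by
  rw [P, Finset.sum_range]

@[simp] lemma P_zero : P α β 0 = 1 := by rw [P_eq]; simp

lemma monic_and_natDegree_P (n : ℕ) : (P α β n).Monic ∧ (P α β n).natDegree = n := by
  induction n using Nat.strong_induction_on with
  | _ n ih =>
    have h1 : (∑ k ∈ Finset.range n,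
        C (ip α β (X ^ n) (P α β k) / ip α β (P α β k) (P α β k)) * P α β k).degree < n := by
      refine lt_of_le_of_lt (degree_sum_le _ _) ?_
      refine (Finset.sup_lt_iff (WithBot.bot_lt_coe n)).2 ?_
      intro k hk
      have hk' := Finset.mem_range.1 hk
      refine lt_of_le_of_lt (degree_C_mul_le _ _) ?_
      rw [degree_eq_natDegree (ih k hk').1.ne_zero, (ih k hk').2]
      exact WithBot.coe_lt_coe.2 hk'
    rw [P_eq]
    have hm := monic_X_pow_sub h1
    refine ⟨hm, ?_⟩
    have h2 : (X ^ n - ∑ k ∈ Finset.range n,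
        C (ip α β (X ^ n) (P α β k) / ip α β (P α β k) (P α β k)) * P α β k).degree = (n : WithBot ℕ) := by
      rw [degree_sub_eq_left_of_degree_lt] <;> rw [degree_X_pow]
      exact h1
    exact natDegree_eq_of_degree_eq_some h2

lemma monic_P (n : ℕ) : (P α β n).Monic := (monic_and_natDegree_P n).1

@[simp] lemma natDegree_P (n : ℕ) : (P α β n).natDegree = n := (monic_and_natDegree_P n).2

lemma degree_P (n : ℕ) : (P α β n).degree = n := by
  rw [degree_eq_natDegree (monic_P n).ne_zero, natDegree_P]

lemma h_eq (ho : Ordered α β) (n : ℕ) : h α β n = functional ho (P α β n * P α β n) := ip_eq ho _ _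

lemma h_pos (ho : StrictlyOrdered α β) (n : ℕ) : 0 < h α β n := by
  rw [h_eq ho.ordered]; exact functional_mul_self_pos ho (monic_P n).ne_zero

lemma functional_P_mul_P (ho : StrictlyOrdered α β) {n k : ℕ} (hk : k < n) :
    functional ho.ordered (P α β n * P α β k) = 0 := by
  induction n using Nat.strong_induction_on generalizing k with
  | _ n ih =>
    have hsymm : ∀ i < n, i ≠ k → functional ho.ordered (P α β i * P α β k) = 0 := by
      intro i hi hik
      rcases lt_or_gt_of_ne hik with h | h
      · rw [mul_comm]; exact ih k hk h
      · exact ih i hi h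
    rw [P_eq n, sub_mul, map_sub, Finset.sum_mul, map_sum, Finset.sum_eq_single k]
    · rw [mul_assoc, functional_C_mul, ip_eq ho.ordered, ip_eq ho.ordered,
        div_mul_cancel₀ _ (functional_mul_self_pos ho (monic_P k).ne_zero).ne', sub_self]
    · intro i hi hik
      rw [mul_assoc, functional_C_mul, hsymm i (Finset.mem_range.1 hi) hik, mul_zero]
    · intro h; exact absurd (Finset.mem_range.2 hk) h

/-- Orthogonality to `P_0, …, P_{m-1}` implies orthogonality to all polynomials of degree `< m`. -/
lemma functional_mul_eq_zero (ho : Ordered α β) {p : ℝ[X]} {m : ℕ}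
    (hp : ∀ k < m, functional ho (p * P α β k) = 0) {q : ℝ[X]} (hq : q.degree < m) :
    functional ho (p * q) = 0 := by
  induction m generalizing q with
  | zero =>
    have : q = 0 := by rw [← degree_eq_bot]; simpa using hq
    simp [this]
  | succ m ih =>
    have h1 : (q - C (q.coeff m) * P α β m).degree < m := by
      rw [degree_lt_iff_coeff_zero]
      intro k hk
      rcases hk.eq_or_lt with rfl | hk
      · have := (monic_P (α := α) (β := β) m).coeff_natDegree
        rw [natDegree_P] at this
        simp [this]
      · rw [coeff_sub, coeff_C_mul, coeff_eq_zero_of_degree_lt (p := P α β m),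
          coeff_eq_zero_of_degree_lt (p := q)]
        · simp
        · exact hq.trans_le (by exact_mod_cast hk)
        · rw [degree_P]; exact_mod_cast hk
    have h2 := ih (fun k hk => hp k (hk.trans m.lt_succ_self)) h1
    rw [mul_sub, map_sub, mul_left_comm, functional_C_mul, hp m m.lt_succ_self] at h2
    linarith

lemma functional_P_mul (ho : StrictlyOrdered α β) {n : ℕ} {q : ℝ[X]} (hq : q.degree < n) :
    functional ho.ordered (P α β n * q) = 0 :=
  functional_mul_eq_zero ho.ordered (fun _ hk => functional_P_mul_P ho hk) hq

lemma functional_P_mul_monic (ho : StrictlyOrdered α β) {n : ℕ} {q : ℝ[X]} (hq : q.Monic)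
    (hn : q.natDegree = n) : functional ho.ordered (P α β n * q) = h α β n := by
  have h1 : (q - P α β n).degree < n := by
    have := degree_sub_lt_left (p := q) (q := P α β n)
      (by rw [degree_P, degree_eq_natDegree hq.ne_zero, hn]) hq.ne_zero
      (by rw [hq.leadingCoeff, (monic_P n).leadingCoeff])
    rwa [degree_eq_natDegree hq.ne_zero, hn] at this
  have h2 := functional_P_mul ho h1
  rw [mul_sub, map_sub, ← h_eq] at h2
  linarith

lemma functional_P (ho : StrictlyOrdered α β) {n : ℕ} (hn : 1 ≤ n) :
    functional ho.ordered (P α β n) = 0 := by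
  have := functional_P_mul ho (n := n) (q := 1) (by rw [degree_one]; exact_mod_cast hn)
  rwa [mul_one] at this

/-- The three-term recurrence. -/
lemma X_mul_P (ho : StrictlyOrdered α β) (n : ℕ) :
    X * P α β (n + 1) = P α β (n + 2) + C (recB α β (n + 2)) * P α β (n + 1) +
      C (recA α β (n + 1)) * P α β n := by
  -- The defect has degree below n + 2 and is orthogonal to P_0, …, P_{n+1}; it is therefore
  -- orthogonal to itself and zero.
  set D := X * P α β (n + 1) - (P α β (n + 2) + C (recB α β (n + 2)) * P α β (n + 1) +
      C (recA α β (n + 1)) * P α β n) with hD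
  have hXd : ∀ k, (X * P α β k).natDegree = k + 1 := fun k => by
    rw [natDegree_X_mul (monic_P k).ne_zero, natDegree_P]
  have hXm : ∀ k, (X * P α β k).Monic := fun k => monic_X.mul (monic_P k)
  have hdeg : D.degree < ((n + 2 : ℕ) : WithBot ℕ) := by
    have h1 : (X * P α β (n + 1) - P α β (n + 2)).degree < ((n + 2 : ℕ) : WithBot ℕ) := by
      have := degree_sub_lt_left (p := X * P α β (n + 1)) (q := P α β (n + 2))
        (by rw [degree_P, degree_eq_natDegree (hXm _).ne_zero, hXd]) (hXm _).ne_zero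
        (by rw [(hXm _).leadingCoeff, (monic_P _).leadingCoeff])
      rwa [degree_eq_natDegree (hXm _).ne_zero, hXd] at this
    have h2 : D = X * P α β (n + 1) - P α β (n + 2) - C (recB α β (n + 2)) * P α β (n + 1) -
      C (recA α β (n + 1)) * P α β n := by rw [hD]; ring
    rw [h2]
    refine (degree_sub_le _ _).trans_lt (max_lt ((degree_sub_le _ _).trans_lt (max_lt h1 ?_)) ?_)
    · refine (degree_C_mul_le _ _).trans_lt ?_
      rw [degree_P]; exact_mod_cast Nat.lt_succ_self _
    · refine (degree_C_mul_le _ _).trans_lt ?_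
      rw [degree_P]; exact_mod_cast (by omega)
  have horth : ∀ k < n + 2, functional ho.ordered (D * P α β k) = 0 := by
    intro k hk
    rw [hD, sub_mul, add_mul, add_mul, map_sub, map_add, map_add, mul_assoc (C _), mul_assoc (C _),
      functional_C_mul, functional_C_mul, functional_P_mul_P ho hk]
    have hXX : X * P α β (n + 1) * P α β k = P α β (n + 1) * (X * P α β k) := by ring
    have hn0 := (h_pos ho n).ne'
    have hn1 := (h_pos ho (n + 1)).ne'
    rcases lt_trichotomy k n with h | rfl | h
    · rw [functional_P_mul_P ho (show k < n + 1 by omega), functional_P_mul_P ho h, hXX,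
        functional_P_mul ho]
      · simp
      · rw [degree_eq_natDegree (hXm _).ne_zero, hXd]; exact_mod_cast (by omega)
    · rw [functional_P_mul_P ho (Nat.lt_succ_self _), hXX,
        functional_P_mul_monic ho (hXm _) (hXd _), ← h_eq, recA, Nat.add_sub_cancel]
      field_simp
      ring
    · obtain rfl : k = n + 1 := by omega
      rw [mul_comm (P α β n), functional_P_mul_P ho (Nat.lt_succ_self _), ← h_eq, recB,
        ip_eq ho.ordered, show n + 2 - 1 = n + 1 by omega]
      field_simp
      ring
  have hD0 : D = 0 := by
    by_contra h
    exact (functional_mul_self_pos ho h).ne' (functional_mul_eq_zero ho.ordered horth hdeg)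
  exact sub_eq_zero.1 hD0

lemma P_add_two (ho : StrictlyOrdered α β) (n : ℕ) :
    P α β (n + 2) = (X - C (recB α β (n + 2))) * P α β (n + 1) -
      C (recA α β (n + 1)) * P α β n := by
  linear_combination -(X_mul_P ho n)

lemma recA_pos (ho : StrictlyOrdered α β) (n : ℕ) : 0 < recA α β n :=
  div_pos (h_pos ho _) (h_pos ho _)

lemma h_succ (ho : StrictlyOrdered α β) (n : ℕ) :
    h α β (n + 1) = recA α β (n + 1) * h α β n := by
  rw [recA, Nat.add_sub_cancel, div_mul_cancel₀ _ (h_pos ho n).ne']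

/-- All complex zeros of an orthogonal polynomial are real. -/
lemma im_eq_zero_of_aeval_P (ho : StrictlyOrdered α β) {n : ℕ} {z : ℂ}
    (hz : aeval z (P α β n) = 0) : z.im = 0 := by
  by_contra him
  obtain ⟨q, hq⟩ := quadratic_dvd_of_aeval_eq_zero_im_ne_zero _ hz him
  set r : ℝ[X] := X ^ 2 - C (2 * z.re) * X + C (‖z‖ ^ 2) with hr
  have hrm : r.degree = 2 := by
    have : r = C 1 * X ^ 2 + C (-(2 * z.re)) * X + C (‖z‖ ^ 2) := by
      rw [hr]; simp only [C_neg, C_1]; ring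
    rw [this, degree_quadratic one_ne_zero]
  have hP0 := (monic_P (α := α) (β := β) n).ne_zero
  have hq0 : q ≠ 0 := by rintro rfl; exact hP0 (by rw [hq, mul_zero])
  have hr0 : r ≠ 0 := by rintro h; exact hP0 (by rw [hq, h, zero_mul])
  have hdeg : q.degree < n := by
    rw [← degree_P (α := α) (β := β) n, hq, degree_mul, hrm, degree_eq_natDegree hq0]
    exact_mod_cast (by omega)
  have h1 := functional_P_mul ho hdeg
  -- Here P_n q = r q² with r ≥ 0 on the line, which contradicts the orthogonality of P_n to q.
  have h2 : 0 < functional ho.ordered (P α β n * q) := by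
    refine functional_pos ho (fun x => ?_) (mul_ne_zero hP0 hq0)
    rw [hq, eval_mul, eval_mul, mul_assoc]
    refine mul_nonneg ?_ (mul_self_nonneg _)
    have : r.eval x = (x - z.re) ^ 2 + z.im ^ 2 := by
      have := Complex.sq_norm z
      rw [Complex.normSq_apply] at this
      simp only [hr, eval_add, eval_sub, eval_pow, eval_X, eval_mul, eval_C]
      rw [this]; ring
    rw [this]; positivity
  exact h2.ne' h1

lemma splits_P (ho : StrictlyOrdered α β) (n : ℕ) : (P α β n).Splits := by
  refine Splits.of_splits_map (algebraMap ℝ ℂ) (IsAlgClosed.splits _) fun z hz => ?_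
  have hz' : aeval z (P α β n) = 0 := by
    simpa [eval_map_algebraMap] using (mem_roots'.1 hz).2
  exact ⟨z.re, Complex.ext rfl (by simpa using (im_eq_zero_of_aeval_P ho hz').symm)⟩

/-- A double zero x would give P_n = (X - x)² q, so that P_n q ≥ 0 although P_n is orthogonal to q.
-/
lemma nodup_roots_P (ho : StrictlyOrdered α β) (n : ℕ) : (P α β n).roots.Nodup := by
  rw [Multiset.nodup_iff_count_le_one]
  intro x
  by_contra! hx
  rw [count_roots] at hx
  have hP0 := (monic_P (α := α) (β := β) n).ne_zero
  obtain ⟨q, hq⟩ := (le_rootMultiplicity_iff hP0).1 (show 2 ≤ _ from hx)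
  have hq0 : q ≠ 0 := by rintro rfl; exact hP0 (by rw [hq, mul_zero])
  have hdeg : q.degree < n := by
    rw [← degree_P (α := α) (β := β) n, hq, degree_mul, degree_pow, degree_X_sub_C,
      degree_eq_natDegree hq0]
    simp only [nsmul_eq_mul, mul_one]
    exact_mod_cast (by omega)
  have h1 := functional_P_mul ho hdeg
  have h2 : 0 < functional ho.ordered (P α β n * q) := by
    refine functional_pos ho (fun y => ?_) (mul_ne_zero hP0 hq0)
    rw [hq, eval_mul, eval_mul, mul_assoc, eval_pow]
    exact mul_nonneg (sq_nonneg _) (mul_self_nonneg _)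
  exact h2.ne' h1

lemma card_roots_P (ho : StrictlyOrdered α β) (n : ℕ) : (P α β n).roots.toFinset.card = n := by
  rw [Multiset.toFinset_card_of_nodup (nodup_roots_P ho n),
    ← (splits_P ho n).natDegree_eq_card_roots, natDegree_P]

end Orthogonal

/-! ### Polynomials and functions of the second kind -/

section SecondKind

open MeasureTheory

variable {g : ℕ} {α β : Fin g → ℝ}

/-- The polynomials of the second kind, by the three-term recurrence. -/
noncomputable def secondPoly (α β : Fin g → ℝ) : ℕ → ℝ[X]
  | 0 => 0
  | 1 => C (h α β 0)
  | n + 2 => (X - C (recB α β (n + 2))) * secondPoly α β (n + 1) -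
      C (recA α β (n + 1)) * secondPoly α β n

@[simp] lemma secondPoly_zero : secondPoly α β 0 = 0 := by rw [secondPoly]

@[simp] lemma secondPoly_one : secondPoly α β 1 = C (h α β 0) := by rw [secondPoly]

lemma secondPoly_add_two (n : ℕ) :
    secondPoly α β (n + 2) = (X - C (recB α β (n + 2))) * secondPoly α β (n + 1) -
      C (recA α β (n + 1)) * secondPoly α β n := by rw [secondPoly]

lemma h_zero (ho : Ordered α β) : h α β 0 = ∫ t in bandSet α β, weight α β t := by
  simp [h_eq ho, functional_apply]

/-- At t = z the difference quotient in Q_n has the default value of a division by zero. That point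
is null and can be discarded before any algebra on the integrand. -/
lemma ae_ofReal_ne (z : ℂ) : ∀ᵐ t : ℝ ∂volume.restrict (bandSet α β), z - (t : ℂ) ≠ 0 := by
  refine ae_restrict_of_ae (Set.Countable.ae_notMem (s := {t : ℝ | z - (t : ℂ) = 0}) ?_ _)
  refine Set.Subsingleton.countable fun s hs t ht => ?_
  have h1 : z - (s : ℂ) = 0 := hs
  have h2 : z - (t : ℂ) = 0 := ht
  exact_mod_cast (sub_eq_zero.1 h1).symm.trans (sub_eq_zero.1 h2)

lemma Ordered.integrableOn_mul_ofReal_weight (ho : Ordered α β) {f : ℝ → ℂ} (hf : Continuous f) :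
    IntegrableOn (fun t => f t * (weight α β t : ℂ)) (bandSet α β) := by
  have h1 : IntegrableOn (fun t => (weight α β t : ℂ)) (bandSet α β) :=
    ho.integrableOn_weight.ofReal
  exact h1.continuousOn_mul hf.continuousOn isCompact_bandSet

/-- The integrand of `Q_n(z)` is integrable. -/
lemma Ordered.integrableOn_divDiff (ho : Ordered α β) (p : ℝ[X]) (z : ℂ) :
    IntegrableOn (fun t : ℝ => (aeval z p - ((p.eval t : ℝ) : ℂ)) / (z - (t : ℂ)) *
      (weight α β t : ℂ)) (bandSet α β) := by
  have hr : (p.map (algebraMap ℝ ℂ) - C (aeval z p)).IsRoot z := by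
    simp [eval_map_algebraMap]
  -- The divided difference agrees with the polynomial q in t away from t = z.
  obtain ⟨q, hq⟩ := dvd_iff_isRoot.2 hr
  have hc : Continuous fun t : ℝ => q.eval (t : ℂ) := q.continuous.comp Complex.continuous_ofReal
  refine (ho.integrableOn_mul_ofReal_weight hc).congr ?_
  filter_upwards [ae_ofReal_ne z] with t ht
  have h1 := congrArg (fun r => r.eval (t : ℂ)) hq
  simp only [eval_sub, eval_mul, eval_X, eval_C, eval_map_algebraMap] at h1
  have h2 : aeval (t : ℂ) p = ((p.eval t : ℝ) : ℂ) := by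
    rw [← Complex.coe_algebraMap, aeval_algebraMap_apply]; simp
  rw [h2] at h1
  congr 1
  rw [eq_div_iff ht]
  linear_combination h1

lemma Q_zero (z : ℂ) : Q α β 0 z = 0 := by simp [Q]

lemma P_one_eq : ∃ c, P α β 1 = X - C c := by
  refine ⟨ip α β X 1 / ip α β 1 1, ?_⟩
  rw [P_eq]
  simp

lemma Q_one (ho : Ordered α β) (z : ℂ) : Q α β 1 z = h α β 0 := by
  obtain ⟨c, hc⟩ := P_one_eq (α := α) (β := β)
  rw [h_zero ho, ← integral_complex_ofReal, Q]
  refine integral_congr_ae ?_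
  filter_upwards [ae_ofReal_ne z] with t ht
  have : (aeval z (P α β 1) - (((P α β 1).eval t : ℝ) : ℂ)) = z - t := by rw [hc]; simp
  rw [this, div_self ht, one_mul]

/-- The divided difference of (X - b) P_{n+1} is (z - b) times that of P_{n+1}, plus P_{n+1}(t). The
extra term integrates to zero against w. -/
lemma Q_add_two (ho : StrictlyOrdered α β) (n : ℕ) (z : ℂ) :
    Q α β (n + 2) z = (z - recB α β (n + 2)) * Q α β (n + 1) z - recA α β (n + 1) * Q α β n z := by
  have h0 : ∫ t in bandSet α β, (((P α β (n + 1)).eval t : ℝ) : ℂ) * (weight α β t : ℂ) = 0 := by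
    have := functional_P ho (n := n + 1) (by omega)
    rw [functional_apply] at this
    have h2 := congrArg (fun r : ℝ => (r : ℂ)) this
    rw [← integral_complex_ofReal] at h2
    simpa using h2
  have i0 := ho.ordered.integrableOn_divDiff (P α β n) z
  have i1 := ho.ordered.integrableOn_divDiff (P α β (n + 1)) z
  have i2 : IntegrableOn (fun t : ℝ => (((P α β (n + 1)).eval t : ℝ) : ℂ) * (weight α β t : ℂ))
      (bandSet α β) := ho.ordered.integrableOn_mul_ofReal_weight
        (Complex.continuous_ofReal.comp (P α β (n + 1)).continuous)
  have e : Q α β (n + 2) z = ∫ t in bandSet α β,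
      ((z - recB α β (n + 2)) * ((aeval z (P α β (n + 1)) - (((P α β (n + 1)).eval t : ℝ) : ℂ)) /
        (z - (t : ℂ)) * (weight α β t : ℂ)) - recA α β (n + 1) *
        ((aeval z (P α β n) - (((P α β n).eval t : ℝ) : ℂ)) / (z - (t : ℂ)) * (weight α β t : ℂ)) +
        (((P α β (n + 1)).eval t : ℝ) : ℂ) * (weight α β t : ℂ)) := by
    rw [Q]
    refine integral_congr_ae ?_
    filter_upwards [ae_ofReal_ne z] with t ht
    rw [P_add_two ho]
    simp only [map_sub, map_mul, aeval_X, aeval_C, eval_sub, eval_mul, eval_X, eval_C,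
      Complex.coe_algebraMap, Complex.ofReal_sub, Complex.ofReal_mul]
    field_simp
    ring
  rw [e, integral_add, integral_sub (i1.const_mul _) (i0.const_mul _), integral_const_mul,
    integral_const_mul, h0, add_zero]
  · rfl
  · exact (i1.const_mul _).sub (i0.const_mul _)
  · exact i2

lemma Q_eq_aeval (ho : StrictlyOrdered α β) (n : ℕ) (z : ℂ) :
    Q α β n z = aeval z (secondPoly α β n) := by
  induction n using Nat.twoStepInduction with
  | zero => simp [Q_zero]
  | one => simp [Q_one ho.ordered]
  | more n ih1 ih2 =>
    rw [Q_add_two ho, ih1, ih2, secondPoly_add_two]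
    simp

/-- The determinant identity for the polynomials of both kinds. -/
lemma P_mul_secondPoly_sub (ho : StrictlyOrdered α β) (n : ℕ) :
    P α β n * secondPoly α β (n + 1) - P α β (n + 1) * secondPoly α β n = C (h α β n) := by
  induction n with
  | zero => simp
  | succ n ih =>
    rw [P_add_two ho, secondPoly_add_two, h_succ ho, C_mul, ← ih]
    ring

/-- The functions of the second kind. -/
noncomputable def psi (α β : Fin g → ℝ) (n : ℕ) (x : ℝ) : ℝ :=
  ∫ t in bandSet α β, (P α β n).eval t / (x - t) * weight α β t

lemma Ordered.integrableOn_div (ho : Ordered α β) (p : ℝ[X]) {x : ℝ} (hx : 1 < x) :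
    IntegrableOn (fun t => p.eval t / (x - t) * weight α β t) (bandSet α β) := by
  refine ho.integrableOn_mul_weight (ContinuousOn.div p.continuous.continuousOn (by fun_prop) ?_)
  intro t ht
  have := (ho.bandSet_subset ht).2
  linarith

lemma Ordered.integral_X_mul_div (ho : Ordered α β) (p : ℝ[X]) {x : ℝ} (hx : 1 < x) :
    ∫ t in bandSet α β, (X * p).eval t / (x - t) * weight α β t =
      x * (∫ t in bandSet α β, p.eval t / (x - t) * weight α β t) - functional ho p := by
  rw [functional_apply, ← integral_const_mul, ← integral_sub ((ho.integrableOn_div p hx).const_mul x)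
    (ho.integrableOn_mul_weight p.continuous.continuousOn)]
  refine setIntegral_congr_fun measurableSet_bandSet fun t ht => ?_
  have : x - t ≠ 0 := by have := (ho.bandSet_subset ht).2; intro h; linarith
  simp only [eval_mul, eval_X]
  field_simp
  ring

lemma psi_add_two (ho : StrictlyOrdered α β) (n : ℕ) {x : ℝ} (hx : 1 < x) :
    psi α β (n + 2) x = (x - recB α β (n + 2)) * psi α β (n + 1) x -
      recA α β (n + 1) * psi α β n x := by
  have h1 := ho.ordered.integral_X_mul_div (P α β (n + 1)) hx
  rw [functional_P ho (by omega), sub_zero] at h1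
  have i0 := ho.ordered.integrableOn_div (P α β n) hx
  have i1 := ho.ordered.integrableOn_div (P α β (n + 1)) hx
  have i2 := ho.ordered.integrableOn_div (X * P α β (n + 1)) hx
  have e : psi α β (n + 2) x = ∫ t in bandSet α β,
      ((X * P α β (n + 1)).eval t / (x - t) * weight α β t -
        recB α β (n + 2) * ((P α β (n + 1)).eval t / (x - t) * weight α β t) -
        recA α β (n + 1) * ((P α β n).eval t / (x - t) * weight α β t)) := by
    rw [psi]
    congr 1
    ext t
    rw [P_add_two ho]
    simp only [eval_sub, eval_mul, eval_X, eval_C]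
    ring
  rw [e, integral_sub, integral_sub i2 (i1.const_mul _), integral_const_mul, integral_const_mul, h1]
  · simp only [psi]
    ring
  · exact i2.sub (i1.const_mul _)
  · exact i0.const_mul _

lemma psi_one (ho : StrictlyOrdered α β) {x : ℝ} (hx : 1 < x) :
    psi α β 1 x = (P α β 1).eval x * psi α β 0 x - h α β 0 := by
  obtain ⟨c, hc⟩ := P_one_eq (α := α) (β := β)
  have h1 := ho.ordered.integral_X_mul_div (1 : ℝ[X]) hx
  have i0 := ho.ordered.integrableOn_div (1 : ℝ[X]) hx
  have i2 := ho.ordered.integrableOn_div (X * (1 : ℝ[X])) hx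
  have e : psi α β 1 x = ∫ t in bandSet α β,
      ((X * (1 : ℝ[X])).eval t / (x - t) * weight α β t -
        c * ((1 : ℝ[X]).eval t / (x - t) * weight α β t)) := by
    rw [psi]
    congr 1
    ext t
    rw [hc]
    simp only [eval_sub, eval_mul, eval_X, eval_C, eval_one]
    ring
  rw [e, integral_sub i2 (i0.const_mul _), integral_const_mul, h1, h_eq ho.ordered]
  simp only [psi, P_zero, hc, eval_sub, eval_X, eval_C, mul_one]
  ring

lemma psi_eq (ho : StrictlyOrdered α β) (n : ℕ) {x : ℝ} (hx : 1 < x) :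
    psi α β n x = (P α β n).eval x * psi α β 0 x - (secondPoly α β n).eval x := by
  induction n using Nat.twoStepInduction with
  | zero => simp
  | one => simp [psi_one ho hx]
  | more n ih1 ih2 =>
    rw [psi_add_two ho n hx, ih1, ih2, secondPoly_add_two, P_add_two ho]
    simp only [eval_sub, eval_mul, eval_X, eval_C]
    ring

/-- Since t/(x - t) = x/(x - t) - 1, trading a factor x for a factor t costs ∫ t^i P_n w with i < j
≤ n, which is zero. Up to n powers of x can be absorbed, and this is where the decay of ψ_n comes
from. -/
lemma pow_mul_psi (ho : StrictlyOrdered α β) {n j : ℕ} (hj : j ≤ n) {x : ℝ} (hx : 1 < x) :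
    x ^ j * psi α β n x =
      ∫ t in bandSet α β, (X ^ j * P α β n).eval t / (x - t) * weight α β t := by
  induction j with
  | zero => simp [psi]
  | succ j ih =>
    rw [pow_succ' X, mul_assoc, ho.ordered.integral_X_mul_div _ hx, ← ih (by omega), mul_comm (X ^ j),
      functional_P_mul ho (by rw [degree_X_pow]; exact_mod_cast hj)]
    ring

/-- The functions of the second kind decay geometrically. -/
lemma abs_psi_le (ho : StrictlyOrdered α β) (n : ℕ) {x : ℝ} (hx : 1 < x) :
    |psi α β n x| ≤ √(h α β n) * ((1 + h α β 0) / (2 * (x - 1))) * (1 / x) ^ n := by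
  have hx0 : 0 < x := by linarith
  have hx1 : 0 < x - 1 := by linarith
  have hh := h_pos ho n
  set s := √(h α β n) with hs
  have hs0 : 0 < s := Real.sqrt_pos.2 hh
  have hss : s * s = h α β n := Real.mul_self_sqrt hh.le
  have i1 := ho.ordered.integrableOn_mul_weight (P α β n * P α β n).continuous.continuousOn
  have i2 := ho.ordered.integrableOn_weight
  have key : |x ^ n * psi α β n x| ≤ s * ((1 + h α β 0) / (2 * (x - 1))) := by
    rw [pow_mul_psi ho le_rfl hx, ← Real.norm_eq_abs]
    calc ‖∫ t in bandSet α β, (X ^ n * P α β n).eval t / (x - t) * weight α β t‖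
        ≤ ∫ t in bandSet α β, ((1 / (2 * (x - 1) * s)) *
          ((P α β n * P α β n).eval t * weight α β t) + (s / (2 * (x - 1))) * weight α β t) := by
          refine norm_integral_le_of_norm_le ((i1.const_mul _).add (i2.const_mul _)) ?_
          rw [ae_restrict_iff' measurableSet_bandSet]
          refine Filter.Eventually.of_forall fun t ht => ?_
          have ht' := ho.ordered.bandSet_subset ht
          have hw := weight_nonneg (α := α) (β := β) t
          have hxt : 0 < x - t := by linarith [ht'.2]
          rw [Real.norm_eq_abs, abs_mul, abs_of_nonneg hw, abs_div, abs_of_pos hxt, eval_mul,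
            eval_mul, eval_pow, eval_X, abs_mul, abs_pow]
          have ht1 : |t| ^ n ≤ 1 := pow_le_one₀ (abs_nonneg t) (abs_le.2 ht')
          set a := (P α β n).eval t
          have h1 : |t| ^ n * |a| / (x - t) ≤ |a| / (x - 1) := by
            refine div_le_div₀ (abs_nonneg a) ?_ hx1 (by linarith [ht'.2])
            exact mul_le_of_le_one_left (abs_nonneg a) ht1
          -- The arithmetic-geometric inequality |a| ≤ (a²/s + s)/2. With s = √h_n both terms
          -- integrate to multiples of s.
          have h2 : |a| / (x - 1) ≤ 1 / (2 * (x - 1) * s) * (a * a) + s / (2 * (x - 1)) := by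
            have e : 1 / (2 * (x - 1) * s) * (a * a) + s / (2 * (x - 1)) - |a| / (x - 1) =
                (|a| - s) ^ 2 / (2 * (x - 1) * s) := by
              rw [← abs_mul_abs_self a]
              field_simp
              ring
            have : 0 ≤ (|a| - s) ^ 2 / (2 * (x - 1) * s) := by positivity
            linarith
          calc |t| ^ n * |a| / (x - t) * weight α β t
              ≤ (1 / (2 * (x - 1) * s) * (a * a) + s / (2 * (x - 1))) * weight α β t :=
                mul_le_mul_of_nonneg_right (h1.trans h2) hw
            _ = _ := by ring
      _ = s * ((1 + h α β 0) / (2 * (x - 1))) := by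
          rw [integral_add (i1.const_mul _) (i2.const_mul _), integral_const_mul,
            integral_const_mul, ← functional_apply ho.ordered, ← h_eq, ← h_zero ho.ordered, ← hss]
          field_simp
  rw [abs_mul, abs_of_pos (pow_pos hx0 n)] at key
  rw [div_pow, one_pow, mul_one_div, le_div_iff₀ (pow_pos hx0 n), mul_comm]
  exact key

end SecondKind

/-! ### Cauchy's theorem in the upper half-plane -/

section HalfPlane

open MeasureTheory Filter Topology Complex

/-- If `f` is holomorphic in the upper half-plane and `O(|z|⁻²)` at infinity, and `Im f` has
boundary values `u` that are attained in a dominated way, then the integral of `u` over the real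
line vanishes. -/
lemma tendsto_integral_boundary_im {f : ℂ → ℂ} {u φ : ℝ → ℝ} {B R : ℝ}
    (hf : DifferentiableOn ℂ f {z | 0 < z.im})
    (hdecay : ∀ z : ℂ, 0 < z.im → R ≤ ‖z‖ → ‖f z‖ ≤ B / ‖z‖ ^ 2)
    (hlim : ∀ᵐ x : ℝ, Tendsto (fun ε : ℝ => (f (x + ε * I)).im) (𝓝[>] 0) (𝓝 (u x)))
    (hdom : ∀ᶠ ε : ℝ in 𝓝[>] 0, ∀ᵐ x : ℝ, ‖f (x + ε * I)‖ ≤ φ x)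
    (hφ : ∀ c d, IntervalIntegrable φ volume c d) :
    Tendsto (fun L : ℝ => ∫ x in (-L)..L, u x) atTop (𝓝 0) := by
  have hcont : ∀ ε : ℝ, 0 < ε → Continuous fun x : ℝ => f (x + ε * I) := by
    intro ε hε
    refine hf.continuousOn.comp_continuous (by fun_prop) fun x => ?_
    simpa using hε
  -- Cauchy's theorem on the rectangle with corners -L + iε and L + iL. The other three sides have
  -- total length at most 4L and stay at distance at least L from 0, where |f| ≤ B/L².
  have hbound : ∀ L : ℝ, max R 1 ≤ L → ∀ ε : ℝ, 0 < ε → ε < L →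
      |∫ x in (-L)..L, (f (x + ε * I)).im| ≤ 4 * B / L := by
    intro L hL ε hε hεL
    have hL1 : 1 ≤ L := (le_max_right _ _).trans hL
    have hLR : R ≤ L := (le_max_left _ _).trans hL
    have hL0 : 0 < L := by linarith
    have hnear : ∀ z : ℂ, 0 < z.im → L ≤ ‖z‖ → ‖f z‖ ≤ B / L ^ 2 := by
      intro z hz hzL
      have h1 := hdecay z hz (hLR.trans hzL)
      have hz0 : 0 < ‖z‖ := hL0.trans_le hzL
      have hB : 0 ≤ B := by
        by_contra! hB
        have : B / ‖z‖ ^ 2 < 0 := div_neg_of_neg_of_pos hB (by positivity)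
        linarith [norm_nonneg (f z)]
      refine h1.trans (div_le_div_of_nonneg_left hB (by positivity) ?_)
      gcongr
    have hrect := integral_boundary_rect_eq_zero_of_differentiableOn f (⟨-L, ε⟩ : ℂ) (⟨L, L⟩ : ℂ)
      (hf.mono fun z hz => by
        have h2 := hz.2
        simp only [Set.mem_preimage, Set.uIcc_of_le hεL.le] at h2
        exact hε.trans_le h2.1)
    simp only at hrect
    have e1 : ‖∫ x : ℝ in (-L)..L, f (x + L * I)‖ ≤ B / L ^ 2 * |L - -L| := by
      refine intervalIntegral.norm_integral_le_of_norm_le_const fun x _ => hnear _ (by simpa) ?_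
      have := abs_im_le_norm (x + L * I : ℂ)
      simp only [add_im, ofReal_im, mul_im, ofReal_re, I_im, I_re] at this
      refine le_trans ?_ this
      simp [abs_of_pos hL0]
    have e2 : ∀ c : ℝ, |c| = L → ‖I • ∫ y : ℝ in ε..L, f (c + y * I)‖ ≤ B / L ^ 2 * |L - ε| := by
      intro c hc
      rw [norm_smul, norm_I, one_mul]
      refine intervalIntegral.norm_integral_le_of_norm_le_const fun y hy => hnear _ ?_ ?_
      · rw [Set.uIoc_of_le hεL.le] at hy
        simpa using hε.trans hy.1
      · have := abs_re_le_norm (c + y * I : ℂ)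
        simpa [hc] using this
    have e3 := e2 L (abs_of_pos hL0)
    have e4 := e2 (-L) (by rw [abs_neg, abs_of_pos hL0])
    have hB : 0 ≤ B / L ^ 2 := (norm_nonneg _).trans (hnear (L * I) (by simpa) (by simp [abs_of_pos hL0]))
    have e5 : ‖∫ x : ℝ in (-L)..L, f (x + ε * I)‖ ≤ 4 * B / L := by
      have : ∫ x : ℝ in (-L)..L, f (x + ε * I) = (∫ x : ℝ in (-L)..L, f (x + L * I)) -
          I • (∫ y : ℝ in ε..L, f ((L : ℝ) + y * I)) +
          I • (∫ y : ℝ in ε..L, f ((-L : ℝ) + y * I)) := by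
        linear_combination hrect
      rw [this]
      refine (norm_add_le _ _).trans ((add_le_add (norm_sub_le _ _) le_rfl).trans ?_)
      have h6 : B / L ^ 2 * |L - -L| = 2 * B / L := by
        rw [abs_of_pos (by linarith)]; field_simp; ring
      have h7 : B / L ^ 2 * |L - ε| ≤ B / L := by
        rw [abs_of_pos (by linarith)]
        calc B / L ^ 2 * (L - ε) ≤ B / L ^ 2 * L := by gcongr; linarith
          _ = B / L := by field_simp
      calc _ ≤ 2 * B / L + B / L + B / L := add_le_add (add_le_add (e1.trans_eq h6) (e3.trans h7))
            (e4.trans h7)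
        _ = 4 * B / L := by ring
    have e6 : ∫ x in (-L)..L, (f (x + ε * I)).im = (∫ x : ℝ in (-L)..L, f (x + ε * I)).im := by
      exact imCLM.intervalIntegral_comp_comm ((hcont ε hε).intervalIntegrable _ _)
    rw [e6]
    exact (abs_im_le_norm _).trans e5
  have hbound' : ∀ L : ℝ, max R 1 ≤ L → |∫ x in (-L)..L, u x| ≤ 4 * B / L := by
    intro L hL
    have hL0 : 0 < L := lt_of_lt_of_le one_pos ((le_max_right _ _).trans hL)
    have ht : Tendsto (fun ε : ℝ => ∫ x in (-L)..L, (f (x + ε * I)).im) (𝓝[>] 0)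
        (𝓝 (∫ x in (-L)..L, u x)) := by
      refine intervalIntegral.tendsto_integral_filter_of_dominated_convergence φ ?_ ?_ (hφ _ _) ?_
      · filter_upwards [self_mem_nhdsWithin] with ε hε
        exact (continuous_im.comp (hcont ε hε)).aestronglyMeasurable
      · filter_upwards [hdom] with ε hε
        filter_upwards [hε] with x hx _
        exact (abs_im_le_norm _).trans hx
      · filter_upwards [hlim] with x hx _
        exact hx
    refine le_of_tendsto ht.abs ?_
    filter_upwards [Ioo_mem_nhdsGT hL0] with ε hε
    exact hbound L hL ε hε.1 hε.2
  refine squeeze_zero_norm' (a := fun L => 4 * B / L) ?_ ?_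
  · filter_upwards [eventually_ge_atTop (max R 1)] with L hL
    exact hbound' L hL
  · exact tendsto_const_nhds.div_atTop tendsto_id

end HalfPlane

/-! ### Square root with boundary values from above -/

section SquareRoot

open Filter Topology Complex

/-- The principal square root; on the negative axis it is the boundary value from above. -/
noncomputable def csqrt (z : ℂ) : ℂ := z ^ (2⁻¹ : ℂ)

lemma csqrt_sq (z : ℂ) : csqrt z ^ 2 = z := by
  simp [csqrt]

lemma norm_csqrt (z : ℂ) : ‖csqrt z‖ = √‖z‖ := by
  rw [eq_comm, Real.sqrt_eq_iff_mul_self_eq (norm_nonneg _) (norm_nonneg _), ← norm_mul, ← sq,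
    csqrt_sq]

lemma csqrt_ne_zero {z : ℂ} (hz : z ≠ 0) : csqrt z ≠ 0 := by
  intro h
  have := csqrt_sq z
  rw [h] at this
  exact hz (by simpa using this.symm)

lemma differentiableAt_csqrt {z : ℂ} (hz : z ∈ slitPlane) : DifferentiableAt ℂ csqrt z :=
  differentiableAt_id.cpow_const hz

lemma csqrt_ofReal {x : ℝ} (hx : 0 ≤ x) : csqrt x = √x := by
  rw [csqrt, Real.sqrt_eq_rpow, ofReal_cpow hx]
  norm_num

lemma csqrt_ofReal_neg {x : ℝ} (hx : x < 0) : csqrt x = I * √(-x) := by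
  have h1 : csqrt x = (-x : ℂ) ^ (2⁻¹ : ℂ) * exp (Real.pi * I * 2⁻¹) := by
    rw [csqrt, ofReal_cpow_of_nonpos hx.le]
  have h2 : csqrt ((-x : ℝ) : ℂ) = √(-x) := csqrt_ofReal (by linarith)
  rw [csqrt, ofReal_neg] at h2
  rw [h1, h2, show (Real.pi * I * 2⁻¹ : ℂ) = Real.pi / 2 * I by ring, exp_pi_div_two_mul_I]
  ring

/-- On the negative axis the principal logarithm is continuous only from above; there the approach
through the upper half-plane is essential. -/
lemma tendsto_csqrt {x : ℝ} (hx : x ≠ 0) :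
    Tendsto (fun ε : ℝ => csqrt (x + ε * I)) (𝓝[>] 0) (𝓝 (csqrt x)) := by
  have hc : ContinuousWithinAt csqrt {z | 0 ≤ z.im} (x : ℂ) := by
    rcases lt_or_gt_of_ne hx with h | h
    · have hl : ContinuousWithinAt log {z | 0 ≤ z.im} (x : ℂ) :=
        continuousWithinAt_log_of_re_neg_of_im_zero (by simpa) (by simp)
      have h2 : ContinuousWithinAt (fun z => exp (log z * 2⁻¹)) {z | 0 ≤ z.im} (x : ℂ) :=
        (hl.mul continuousWithinAt_const).cexp
      refine h2.congr_of_eventuallyEq ?_ ?_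
      · have : {z : ℂ | z ≠ 0} ∈ 𝓝 (x : ℂ) :=
          isOpen_ne.mem_nhds (ofReal_ne_zero.2 hx)
        filter_upwards [mem_nhdsWithin_of_mem_nhds this] with z hz
        rw [csqrt, cpow_def_of_ne_zero hz]
      · rw [csqrt, cpow_def_of_ne_zero (by exact_mod_cast hx)]
    · exact (differentiableAt_csqrt (by simp [slitPlane, h])).continuousAt.continuousWithinAt
  refine hc.tendsto.comp (tendsto_nhdsWithin_iff.2 ⟨?_, ?_⟩)
  · have h3 : Continuous fun ε : ℝ => (x + ε * I : ℂ) := by fun_prop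
    have := h3.tendsto 0
    simp only [ofReal_zero, zero_mul, add_zero] at this
    exact this.mono_left nhdsWithin_le_nhds
  · filter_upwards [self_mem_nhdsWithin] with ε hε
    simpa using (le_of_lt hε)

lemma im_eq_zero_of_sq {z : ℂ} {r : ℝ} (hr : 0 < r) (h : z ^ 2 = r) : z.im = 0 := by
  have h1 := congrArg re h
  have h2 := congrArg im h
  simp only [sq, mul_re, mul_im, ofReal_re, ofReal_im] at h1 h2
  by_contra h3
  have : z.re = 0 := by
    have : z.re * z.im = 0 := by linarith
    exact (mul_eq_zero.1 this).resolve_right h3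
  rw [this] at h1
  nlinarith [mul_self_nonneg z.im]

end SquareRoot

/-! ### The Stieltjes transform of the weight -/

section Stieltjes

open MeasureTheory Filter Topology Complex

variable {g : ℕ} {α β : Fin g → ℝ}

/-- The square root of `∏(z - α_j) / ((z² - 1) ∏(z - β_j))` in the closed upper half-plane. -/
noncomputable def rootFun (α β : Fin g → ℝ) (z : ℂ) : ℂ :=
  (∏ j, csqrt (z - α j)) / (csqrt (z - 1) * csqrt (z + 1) * ∏ j, csqrt (z - β j))

lemma rootFun_sq (z : ℂ) :
    rootFun α β z ^ 2 = (∏ j, (z - α j)) / ((z ^ 2 - 1) * ∏ j, (z - β j)) := by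
  simp only [rootFun, div_pow, mul_pow, ← Finset.prod_pow, csqrt_sq]
  congr 2
  ring

lemma differentiableAt_rootFun {z : ℂ} (hα : ∀ j, z - α j ∈ slitPlane)
    (hβ : ∀ j, z - β j ∈ slitPlane) (h1 : z - 1 ∈ slitPlane) (h2 : z + 1 ∈ slitPlane) :
    DifferentiableAt ℂ (rootFun α β) z := by
  have hs : ∀ a : ℂ, z - a ∈ slitPlane → DifferentiableAt ℂ (fun z => csqrt (z - a)) z :=
    fun a ha => DifferentiableAt.comp z (differentiableAt_csqrt ha)
      (differentiableAt_id.sub_const a)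
  have hp : ∀ γ : Fin g → ℝ, (∀ j, z - γ j ∈ slitPlane) →
      DifferentiableAt ℂ (fun z => ∏ j, csqrt (z - γ j)) z :=
    fun γ hγ => DifferentiableAt.fun_finsetProd fun j _ => hs _ (hγ j)
  refine (hp α hα).div (((hs 1 h1).mul ?_).mul (hp β hβ)) ?_
  · simpa using hs (-1) (by simpa using h2)
  · refine mul_ne_zero (mul_ne_zero ?_ ?_) (Finset.prod_ne_zero_iff.2 fun j _ => ?_)
    · exact csqrt_ne_zero (slitPlane_ne_zero h1)
    · exact csqrt_ne_zero (slitPlane_ne_zero h2)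
    · exact csqrt_ne_zero (slitPlane_ne_zero (hβ j))

lemma differentiableOn_rootFun : DifferentiableOn ℂ (rootFun α β) {z | 0 < z.im} := by
  intro z hz
  have hz' : z.im ≠ 0 := ne_of_gt hz
  refine (differentiableAt_rootFun ?_ ?_ ?_ ?_).differentiableWithinAt
  · exact fun j => Or.inr (by simpa using hz')
  · exact fun j => Or.inr (by simpa using hz')
  · exact Or.inr (by simpa using hz')
  · exact Or.inr (by simpa using hz')

lemma Ordered.differentiableAt_rootFun_of_one_lt (ho : Ordered α β) {x : ℝ} (hx : 1 < x) :
    DifferentiableAt ℂ (rootFun α β) x := by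
  have h : ∀ a : ℝ, a ≤ 1 → (x : ℂ) - a ∈ slitPlane := fun a ha => by
    rw [← ofReal_sub, ofReal_mem_slitPlane]; linarith
  refine differentiableAt_rootFun (fun j => h _ (ho.α_lt_one j).le) (fun j => h _ (ho.β_lt_one j).le)
    ?_ ?_
  · simpa using h 1 le_rfl
  · simpa using h (-1) (by norm_num)

lemma norm_rootFun (z : ℂ) : ‖rootFun α β z‖ =
    (∏ j, √‖z - α j‖) / (√‖z - 1‖ * √‖z + 1‖ * ∏ j, √‖z - β j‖) := by
  simp [rootFun, norm_csqrt]

/-- There are g roots in the numerator and g + 2 in the denominator, each comparable with √|z|; the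
surplus of two leaves |z|⁻¹. -/
lemma Ordered.norm_rootFun_le_div (ho : Ordered α β) {z : ℂ} (hz : 2 ≤ ‖z‖) :
    ‖rootFun α β z‖ ≤ 2 * 2 ^ g / ‖z‖ := by
  have hz0 : 0 < ‖z‖ := by linarith
  have up : ∀ a : ℝ, |a| ≤ 1 → ‖z - a‖ ≤ 2 * ‖z‖ := fun a ha => by
    refine (norm_sub_le _ _).trans ?_
    rw [norm_real, Real.norm_eq_abs]; linarith
  have lo : ∀ a : ℝ, |a| ≤ 1 → ‖z‖ / 2 ≤ ‖z - a‖ := fun a ha => by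
    refine le_trans ?_ (norm_sub_norm_le _ _)
    rw [norm_real, Real.norm_eq_abs]; linarith
  have hβ : ∀ j, |β j| ≤ 1 := fun j =>
    abs_le.2 ⟨(ho.neg_one_lt_β j).le, (ho.β_lt_one j).le⟩
  have hα : ∀ j, |α j| ≤ 1 := fun j =>
    abs_le.2 ⟨(ho.neg_one_lt_α j).le, (ho.α_lt_one j).le⟩
  have l1 : ‖z‖ / 2 ≤ ‖z - 1‖ := by simpa using lo 1 (by simp)
  have l2 : ‖z‖ / 2 ≤ ‖z + 1‖ := by simpa using lo (-1) (by simp)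
  have hs : 0 < √(‖z‖ / 2) := Real.sqrt_pos.2 (by positivity)
  rw [norm_rootFun]
  calc (∏ j, √‖z - α j‖) / (√‖z - 1‖ * √‖z + 1‖ * ∏ j, √‖z - β j‖)
      ≤ (∏ _j : Fin g, √(2 * ‖z‖)) / (√(‖z‖ / 2) * √(‖z‖ / 2) * ∏ _j : Fin g, √(‖z‖ / 2)) := by
        gcongr with j _ j _
        · exact up _ (hα j)
        · exact lo _ (hβ j)
    _ = 2 * 2 ^ g / ‖z‖ := by
        rw [Finset.prod_const, Finset.prod_const, Finset.card_univ, Fintype.card_fin,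
          Real.mul_self_sqrt (by positivity), mul_comm (‖z‖ / 2), ← div_div, ← div_pow,
          ← Real.sqrt_div (by positivity), show 2 * ‖z‖ / (‖z‖ / 2) = 2 ^ 2 by field_simp,
          Real.sqrt_sq (by norm_num)]
        field_simp

/-- Moving up from x to x + iε only increases the distance to real points, so one integrable bound
serves all ε. -/
lemma Ordered.norm_rootFun_le (ho : Ordered α β) {x ε : ℝ} (hε : 0 ≤ ε) (hε1 : ε ≤ 1)
    (hx : x ∉ singSet β) : ‖rootFun α β (x + ε * I)‖ ≤
      (∏ j, √(|x - α j| + 1)) * ∏ b ∈ singSet β, (√|x - b|)⁻¹ := by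
  have up : ∀ a : ℝ, ‖(x + ε * I : ℂ) - a‖ ≤ |x - a| + 1 := fun a => by
    rw [show (x + ε * I : ℂ) - a = ((x - a : ℝ) : ℂ) + (ε : ℂ) * I by push_cast; ring]
    refine (norm_add_le _ _).trans ?_
    rw [norm_mul, norm_I, norm_real, norm_real, Real.norm_eq_abs, Real.norm_eq_abs, mul_one,
      abs_of_nonneg hε]
    linarith
  have lo : ∀ a : ℝ, |x - a| ≤ ‖(x + ε * I : ℂ) - a‖ := fun a => by
    have := abs_re_le_norm ((x + ε * I : ℂ) - a)
    simpa using this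
  have pos : ∀ b ∈ singSet β, 0 < √|x - b| := fun b hb => by
    refine Real.sqrt_pos.2 (abs_pos.2 (sub_ne_zero.2 ?_))
    rintro rfl; exact hx hb
  have p1 : 0 < √|x - 1| := pos 1 (by simp [singSet])
  have p2 : 0 < √|x + 1| := by simpa using pos (-1) (by simp [singSet])
  have p3 : ∀ j, 0 < √|x - β j| := fun j => pos (β j) (by simp [singSet])
  have l1 : |x - 1| ≤ ‖(x + ε * I : ℂ) - 1‖ := by simpa using lo 1
  have l2 : |x + 1| ≤ ‖(x + ε * I : ℂ) + 1‖ := by simpa using lo (-1)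
  rw [norm_rootFun]
  have p4 : 0 < ∏ j, √|x - β j| := Finset.prod_pos fun j _ => p3 j
  calc _ ≤ (∏ j, √(|x - α j| + 1)) / (√|x - 1| * √|x + 1| * ∏ j, √|x - β j|) := by
        gcongr with j _ j _
        · exact up _
        · exact lo _
    _ = _ := by
        rw [ho.prod_singSet, Finset.prod_inv_distrib, sub_neg_eq_add]
        field_simp

lemma tendsto_rootFun {x : ℝ} (hα : ∀ j, x ≠ α j) (hx : x ∉ singSet β) :
    Tendsto (fun ε : ℝ => rootFun α β (x + ε * I)) (𝓝[>] 0) (𝓝 (rootFun α β x)) := by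
  have hs : ∀ a : ℝ, x ≠ a → Tendsto (fun ε : ℝ => csqrt ((x + ε * I : ℂ) - a)) (𝓝[>] 0)
      (𝓝 (csqrt (x - a))) := fun a ha => by
    have := tendsto_csqrt (sub_ne_zero.2 ha)
    simp only [ofReal_sub] at this
    refine this.congr fun ε => ?_
    congr 1; ring
  have h1 : x ≠ 1 := by rintro rfl; exact hx (by simp [singSet])
  have h2 : x ≠ -1 := by rintro rfl; exact hx (by simp [singSet])
  have h3 : ∀ j, x ≠ β j := by rintro j rfl; exact hx (by simp [singSet])
  have hne : ∀ a : ℝ, x ≠ a → csqrt (x - a) ≠ 0 := fun a ha =>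
    csqrt_ne_zero (sub_ne_zero.2 (by exact_mod_cast ha))
  refine Tendsto.div (tendsto_finsetProd _ fun j _ => hs _ (hα j))
    (((by simpa using hs 1 h1 : Tendsto _ _ _).mul
      (by simpa using hs (-1) h2 : Tendsto _ _ _)).mul
      (tendsto_finsetProd _ fun j _ => hs _ (h3 j))) ?_
  refine mul_ne_zero (mul_ne_zero ?_ ?_) (Finset.prod_ne_zero_iff.2 fun j _ => hne _ (h3 j))
  · simpa using hne 1 h1
  · simpa using hne (-1) h2

/-- If both numbers are negative, the two factors i cancel. -/
lemma csqrt_div_csqrt {a b : ℝ} (h : 0 < a / b) : csqrt a / csqrt b = √(a / b) := by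
  rcases div_pos_iff.1 h with ⟨ha, hb⟩ | ⟨ha, hb⟩
  · rw [csqrt_ofReal ha.le, csqrt_ofReal hb.le, Real.sqrt_div ha.le, ofReal_div]
  · rw [csqrt_ofReal_neg ha, csqrt_ofReal_neg hb, mul_div_mul_left _ _ I_ne_zero, ← neg_div_neg_eq a,
      Real.sqrt_div (by linarith), ofReal_div]

lemma Ordered.div_pos_of_mem (ho : Ordered α β) {x : ℝ} (hα : ∀ j, x ≠ α j) (hβ : ∀ j, x ≠ β j)
    {j : Fin g} (hj : x ≤ α j ∨ β j ≤ x) : 0 < (x - α j) / (x - β j) := by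
  have h4 := ho.2 j
  rcases hj with h | h
  · have h3 : x < α j := lt_of_le_of_ne h (hα j)
    exact div_pos_of_neg_of_neg (by linarith) (by linarith)
  · have h3 : β j < x := lt_of_le_of_ne h (hβ j).symm
    exact div_pos (by linarith) (by linarith)

/-- On the bands the boundary value of `rootFun` is `-i π w`. -/
lemma Ordered.rootFun_of_mem (ho : Ordered α β) {x : ℝ} (hα : ∀ j, x ≠ α j)
    (hβ : ∀ j, x ≠ β j) (h1 : x ≠ 1) (h2 : x ≠ -1) (hx : x ∈ bandSet α β) :
    rootFun α β x = -I * ((Real.pi * weight α β x : ℝ) : ℂ) := by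
  rw [ho.bandSet_eq] at hx
  obtain ⟨hx1, hx2⟩ := hx
  have h3 : x < 1 := lt_of_le_of_ne hx1.2 h1
  have h4 : -1 < x := lt_of_le_of_ne hx1.1 h2.symm
  have hpos : ∀ j, 0 < (x - α j) / (x - β j) := fun j => ho.div_pos_of_mem hα hβ (hx2 j)
  have e1 : ∏ j, csqrt ((x : ℂ) - α j) / csqrt ((x : ℂ) - β j) =
      ((∏ j, √((x - α j) / (x - β j)) : ℝ) : ℂ) := by
    rw [ofReal_prod]
    refine Finset.prod_congr rfl fun j _ => ?_
    rw [← ofReal_sub, ← ofReal_sub, csqrt_div_csqrt (hpos j)]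
  -- The only factor i that survives comes from √(x - 1); standing in the denominator, it gives the
  -- -i.
  have e2 : csqrt ((x : ℂ) - 1) * csqrt ((x : ℂ) + 1) = I * ((√(1 - x ^ 2) : ℝ) : ℂ) := by
    rw [show (x : ℂ) - 1 = ((x - 1 : ℝ) : ℂ) by push_cast; ring,
      show (x : ℂ) + 1 = ((x + 1 : ℝ) : ℂ) by push_cast; ring,
      csqrt_ofReal_neg (by linarith), csqrt_ofReal (by linarith),
      show 1 - x ^ 2 = -(x - 1) * (x + 1) by ring, Real.sqrt_mul (by linarith), ofReal_mul, mul_assoc]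
  have e3 : Real.pi * weight α β x = (∏ j, √((x - α j) / (x - β j))) / √(1 - x ^ 2) := by
    rw [weight, ← mul_assoc, mul_one_div_cancel Real.pi_ne_zero, one_mul, mul_comm (1 - x ^ 2),
      ← div_div, ← Finset.prod_div_distrib, Real.sqrt_div (Finset.prod_nonneg fun j _ => (hpos j).le),
      Real.sqrt_prod _ fun j _ => (hpos j).le]
  rw [rootFun, e2, mul_comm, ← div_div, ← Finset.prod_div_distrib, e1, e3, ofReal_div, ← div_div,
    div_right_comm, div_I]
  ring

/-- Off the bands the boundary value of `rootFun` is real. -/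
lemma Ordered.rootFun_im_of_notMem (ho : Ordered α β) {x : ℝ} (hα : ∀ j, x ≠ α j)
    (hβ : ∀ j, x ≠ β j) (h1 : x ≠ 1) (h2 : x ≠ -1) (hx : x ∉ bandSet α β) :
    (rootFun α β x).im = 0 := by
  have hsq : rootFun α β x ^ 2 = (((∏ j, (x - α j) / (x - β j)) / (x ^ 2 - 1) : ℝ) : ℂ) := by
    rw [rootFun_sq, Finset.prod_div_distrib, div_div, mul_comm (∏ j, (x - β j))]
    push_cast
    rfl
  -- A number whose square is real and positive is real, so only the sign of N/D matters. Inside a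
  -- gap one quotient and x² - 1 are negative; outside [-1, 1] everything is positive.
  refine im_eq_zero_of_sq ?_ hsq
  rw [ho.bandSet_eq] at hx
  by_cases hx1 : x ∈ Set.Icc (-1) 1
  · obtain ⟨k, hk⟩ : ∃ k, ¬(x ≤ α k ∨ β k ≤ x) := by
      by_contra! h; exact hx ⟨hx1, h⟩
    rw [not_or, not_le, not_le] at hk
    have h3 : x < 1 := lt_of_le_of_ne hx1.2 h1
    have h4 : -1 < x := lt_of_le_of_ne hx1.1 h2.symm
    refine div_pos_of_neg_of_neg ?_ (by nlinarith)
    rw [← Finset.mul_prod_erase _ _ (Finset.mem_univ k)]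
    refine mul_neg_of_neg_of_pos (div_neg_of_pos_of_neg (by linarith) (by linarith))
      (Finset.prod_pos fun j hj => ho.div_pos_of_mem hα hβ ?_)
    rcases lt_or_gt_of_ne (Finset.ne_of_mem_erase hj) with h | h
    · right; linarith [ho.β_lt_α h]
    · left; linarith [ho.β_lt_α h]
  · rw [Set.mem_Icc, not_and_or, not_le, not_le] at hx1
    refine div_pos (Finset.prod_pos fun j _ => ho.div_pos_of_mem hα hβ ?_) ?_
    · rcases hx1 with h | h
      · left; linarith [ho.neg_one_lt_α j]
      · right; linarith [ho.β_lt_one j]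
    · rcases hx1 with h | h <;> nlinarith

lemma Ordered.exists_ofReal_rootFun (ho : Ordered α β) {x : ℝ} (hx : 1 < x) :
    ∃ c : ℝ, rootFun α β x = c := by
  refine ⟨(rootFun α β x).re, Complex.ext rfl ?_⟩
  rw [ofReal_im]
  refine ho.rootFun_im_of_notMem (fun j => ?_) (fun j => ?_) hx.ne' (by linarith)
    fun h => absurd (ho.bandSet_subset h).2 (not_le.2 hx)
  · linarith [ho.α_lt_one j]
  · linarith [ho.β_lt_one j]

/-- The Stieltjes transform of the weight on `(1, ∞)`. -/
lemma Ordered.rootFun_eq_psi_zero (ho : Ordered α β) {y : ℝ} (hy : 1 < y) :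
    rootFun α β y = psi α β 0 y := by
  obtain ⟨c, hc⟩ := ho.exists_ofReal_rootFun hy
  -- Division by z - y creates the Cauchy kernel. The subtracted term equals c at y, which removes
  -- the singularity there. Its pole y - i lies below the axis, and it is O(1/|z|), so f is
  -- O(|z|⁻²). On the line it contributes the Lorentzian in `u`, of integral cπ.
  let f : ℂ → ℂ := fun z => (rootFun α β z - c * (I / (z - y + I))) / (z - y)
  let u : ℝ → ℝ := fun x => (bandSet α β).indicator
    (fun t => Real.pi * ((P α β 0).eval t / (y - t) * weight α β t)) x - c * (1 + (x - y) ^ 2)⁻¹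
  have hden : ∀ z : ℂ, 0 ≤ z.im → z - y + I ≠ 0 := fun z hz h => by
    have := congrArg im h
    simp at this
    linarith
  have hsub : ∀ z : ℂ, 0 < z.im → z - y ≠ 0 := fun z hz h => by
    have := congrArg im h
    simp at this
    linarith
  have hdiff : DifferentiableOn ℂ f {z | 0 < z.im} := by
    have hz1 : ∀ z ∈ {z : ℂ | 0 < z.im}, z - y + I ≠ 0 := fun z hz => hden z (le_of_lt hz)
    have hz2 : ∀ z ∈ {z : ℂ | 0 < z.im}, z - y ≠ 0 := hsub
    exact (differentiableOn_rootFun.sub ((differentiableOn_const _).mul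
      ((differentiableOn_const _).div (by fun_prop) hz1))).div (by fun_prop) hz2
  have hdecay : ∀ z : ℂ, 0 < z.im → 2 * (y + 1) ≤ ‖z‖ →
      ‖f z‖ ≤ ((2 * 2 ^ g + |c| * 2) * 2) / ‖z‖ ^ 2 := by
    intro z hz hzR
    have hz0 : 0 < ‖z‖ := by linarith
    have hny : ‖(y : ℂ)‖ = y := by rw [norm_real, Real.norm_of_nonneg (by linarith)]
    have h1 : ‖z‖ / 2 ≤ ‖z - y‖ := by
      refine le_trans ?_ (norm_sub_norm_le _ _)
      rw [hny]; linarith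
    have h2 : ‖z‖ / 2 ≤ ‖z - y + I‖ := by
      have h3 : ‖z‖ - ‖(y : ℂ) - I‖ ≤ ‖z - (y - I)‖ := norm_sub_norm_le _ _
      have h4 : ‖(y : ℂ) - I‖ ≤ y + 1 := by
        refine (norm_sub_le _ _).trans ?_
        rw [hny, norm_I]
      rw [show z - y + I = z - (y - I) by ring]
      linarith
    simp only [f]
    rw [norm_div]
    calc ‖rootFun α β z - c * (I / (z - y + I))‖ / ‖z - y‖
        ≤ (2 * 2 ^ g / ‖z‖ + |c| * (1 / (‖z‖ / 2))) / (‖z‖ / 2) := by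
          gcongr
          refine (norm_sub_le _ _).trans (add_le_add (ho.norm_rootFun_le_div (by linarith)) ?_)
          rw [norm_mul, norm_div, norm_I, norm_real, Real.norm_eq_abs]
          gcongr
      _ = _ := by field_simp
  have hsing : ∀ᵐ x : ℝ, (∀ j, x ≠ α j) ∧ x ∉ singSet β ∧ x ≠ y := by
    have h1 : ∀ᵐ x : ℝ, x ∉ (Set.range α ∪ (singSet β : Set ℝ) ∪ {y}) :=
      Set.Countable.ae_notMem (((Set.finite_range α).union (Finset.finite_toSet _)).union
        (Set.finite_singleton y)).countable _
    filter_upwards [h1] with x hx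
    simp only [Set.mem_union, Set.mem_range, Finset.mem_coe, Set.mem_singleton_iff, not_or,
      not_exists] at hx
    exact ⟨fun j h => hx.1.1 j h.symm, hx.1.2, hx.2⟩
  have him : ∀ x : ℝ, (∀ j, x ≠ α j) → x ∉ singSet β → x ≠ y → (f x).im = u x := by
    intro x hα hx hxy
    have h1 : x ≠ 1 := by rintro rfl; exact hx (by simp [singSet])
    have h2 : x ≠ -1 := by rintro rfl; exact hx (by simp [singSet])
    have h3 : ∀ j, x ≠ β j := by rintro j rfl; exact hx (by simp [singSet])
    have hxy' : x - y ≠ 0 := sub_ne_zero.2 hxy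
    have e1 : ((c : ℂ) * (I / (x - y + I))).im = c * ((x - y) * (1 + (x - y) ^ 2)⁻¹) := by
      have e : (I / ((x : ℂ) - y + I)) =
          (((1 + (x - y) ^ 2)⁻¹ : ℝ) : ℂ) * (1 + ((x - y : ℝ) : ℂ) * I) := by
        have h5 : (1 + ((x : ℂ) - y) ^ 2) ≠ 0 := by
          have : (1 + (x - y) ^ 2 : ℝ) ≠ 0 := by positivity
          exact_mod_cast this
        rw [div_eq_iff (hden x (by simp))]
        push_cast
        field_simp
        linear_combination (-(x : ℂ) + y) * I_sq
      rw [e, im_ofReal_mul, im_ofReal_mul, add_im, one_im, im_ofReal_mul, I_im]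
      ring
    have e2 : (f x).im = ((rootFun α β x).im - c * ((x - y) * (1 + (x - y) ^ 2)⁻¹)) / (x - y) := by
      simp only [f]
      rw [← ofReal_sub, div_ofReal_im, sub_im, ofReal_sub, e1]
    rw [e2]
    simp only [u]
    by_cases hxE : x ∈ bandSet α β
    · have hyx : y - x ≠ 0 := sub_ne_zero.2 hxy.symm
      rw [Set.indicator_of_mem hxE, ho.rootFun_of_mem hα h3 h1 h2 hxE]
      simp only [neg_mul, neg_im, I_mul_im, ofReal_re, P_zero, eval_one]
      rw [show x - y = -(y - x) by ring]
      field_simp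
      ring
    · rw [Set.indicator_of_notMem hxE, ho.rootFun_im_of_notMem hα h3 h1 h2 hxE]
      field_simp
      ring
  have hlim : ∀ᵐ x : ℝ, Tendsto (fun ε : ℝ => (f (x + ε * I)).im) (𝓝[>] 0) (𝓝 (u x)) := by
    filter_upwards [hsing] with x hx
    rw [← him x hx.1 hx.2.1 hx.2.2]
    refine (continuous_im.tendsto _).comp ?_
    have hz : Tendsto (fun ε : ℝ => (x + ε * I : ℂ)) (𝓝[>] 0) (𝓝 x) := by
      have h3 : Continuous fun ε : ℝ => (x + ε * I : ℂ) := by fun_prop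
      have := h3.tendsto 0
      simp only [ofReal_zero, zero_mul, add_zero] at this
      exact this.mono_left nhdsWithin_le_nhds
    refine ((tendsto_rootFun hx.1 hx.2.1).sub (tendsto_const_nhds.mul (tendsto_const_nhds.div
      ((hz.sub tendsto_const_nhds).add tendsto_const_nhds) (hden x (by simp))))).div
      (hz.sub tendsto_const_nhds) (sub_ne_zero.2 (by exact_mod_cast hx.2.2))
  -- The numerator of f is differentiable at y and vanishes there, so the quotient is bounded
  -- nearby.
  obtain ⟨M, δ, hδ, hM⟩ : ∃ M δ : ℝ, 0 < δ ∧ ∀ z : ℂ, ‖z - y‖ < δ → ‖f z‖ ≤ M := by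
    have hd : DifferentiableAt ℂ (fun z => rootFun α β z - c * (I / (z - y + I))) (y : ℂ) := by
      refine (ho.differentiableAt_rootFun_of_one_lt hy).sub ((differentiableAt_const _).mul
        ((differentiableAt_const _).div (by fun_prop) (hden y (by simp))))
    have hO := hd.isBigO_sub
    have h0 : rootFun α β y - c * (I / ((y : ℂ) - y + I)) = 0 := by
      rw [sub_self, zero_add, div_self I_ne_zero, mul_one, hc, sub_self]
    simp only [h0, sub_zero] at hO
    obtain ⟨M, hM⟩ := hO.bound
    obtain ⟨δ, hδ, hball⟩ := Metric.eventually_nhds_iff.1 hM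
    refine ⟨|M|, δ, hδ, fun z hz => ?_⟩
    have h1 := hball (by rwa [dist_eq])
    simp only [f]
    rw [norm_div]
    rcases (norm_nonneg (z - y)).eq_or_lt with h | h
    · rw [← h, div_zero]; positivity
    · rw [div_le_iff₀ h]
      exact h1.trans (by gcongr; exact le_abs_self M)
  -- The first term dominates near y. Away from y the second does, by |z - y| ≥ δ/2 and |z - y + i|
  -- ≥ 1.
  let φ : ℝ → ℝ := fun x => |M| + ((∏ j, √(|x - α j| + 1)) * ∏ b ∈ singSet β, (√|x - b|)⁻¹ + |c|) *
    (2 / δ)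
  have hφ : ∀ a b, IntervalIntegrable φ volume a b := by
    intro a b
    have hcont : Continuous fun x : ℝ => ∏ j, √(|x - α j| + 1) :=
      continuous_finsetProd _ fun _ _ => by fun_prop
    exact intervalIntegrable_const.add
      ((((intervalIntegrable_prod_inv_sqrt _ a b).continuousOn_mul hcont.continuousOn).add
        intervalIntegrable_const).mul_const _)
  have hdom : ∀ᶠ ε : ℝ in 𝓝[>] 0, ∀ᵐ x : ℝ, ‖f (x + ε * I)‖ ≤ φ x := by
    filter_upwards [Ioo_mem_nhdsGT (show (0 : ℝ) < min 1 (δ / 2) by positivity)] with ε hε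
    have hε1 : ε < 1 := hε.2.trans_le (min_le_left _ _)
    have hε2 : ε < δ / 2 := hε.2.trans_le (min_le_right _ _)
    filter_upwards [hsing] with x hx
    have hA : 0 ≤ (∏ j, √(|x - α j| + 1)) * ∏ b ∈ singSet β, (√|x - b|)⁻¹ :=
      mul_nonneg (Finset.prod_nonneg fun _ _ => by positivity)
        (Finset.prod_nonneg fun _ _ => by positivity)
    have hsplit : (x + ε * I : ℂ) - y = ((x - y : ℝ) : ℂ) + ε * I := by push_cast; ring
    rcases lt_or_ge |x - y| (δ / 2) with hxy | hxy
    · refine (hM _ ?_).trans ((le_abs_self M).trans ?_)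
      · rw [hsplit]
        refine (norm_add_le _ _).trans_lt ?_
        rw [norm_mul, norm_I, norm_real, norm_real, Real.norm_eq_abs, Real.norm_eq_abs, mul_one,
          abs_of_pos hε.1]
        linarith
      · simp only [φ]
        have : 0 ≤ ((∏ j, √(|x - α j| + 1)) * ∏ b ∈ singSet β, (√|x - b|)⁻¹ + |c|) * (2 / δ) := by
          positivity
        linarith
    · have h1 : δ / 2 ≤ ‖(x + ε * I : ℂ) - y‖ := by
        refine hxy.trans ?_
        have := abs_re_le_norm ((x + ε * I : ℂ) - y)
        simpa using this
      have h2 : 1 ≤ ‖(x + ε * I : ℂ) - y + I‖ := by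
        have := abs_im_le_norm ((x + ε * I : ℂ) - y + I)
        simp only [add_im, sub_im, ofReal_im, mul_im, ofReal_re, I_im, I_re] at this
        refine le_trans ?_ this
        rw [abs_of_nonneg] <;> linarith [hε.1]
      simp only [f]
      rw [norm_div]
      calc _ ≤ ((∏ j, √(|x - α j| + 1)) * ∏ b ∈ singSet β, (√|x - b|)⁻¹ + |c| * (1 / 1)) /
            (δ / 2) := by
            gcongr
            refine (norm_sub_le _ _).trans (add_le_add
              (ho.norm_rootFun_le hε.1.le hε1.le hx.2.1) ?_)
            rw [norm_mul, norm_div, norm_I, norm_real, Real.norm_eq_abs]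
            gcongr
        _ = ((∏ j, √(|x - α j| + 1)) * ∏ b ∈ singSet β, (√|x - b|)⁻¹ + |c|) * (2 / δ) := by
            field_simp
        _ ≤ _ := by simp only [φ]; linarith [abs_nonneg M]
  have hT := tendsto_integral_boundary_im hdiff hdecay hlim hdom hφ
  have i1 : Integrable ((bandSet α β).indicator
      (fun t => Real.pi * ((P α β 0).eval t / (y - t) * weight α β t))) := by
    rw [integrable_indicator_iff measurableSet_bandSet]
    exact (ho.integrableOn_div _ hy).const_mul _
  have i2 : Integrable fun x : ℝ => c * (1 + (x - y) ^ 2)⁻¹ :=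
    (integrable_inv_one_add_sq.comp_sub_right y).const_mul c
  have hT2 : Tendsto (fun L : ℝ => ∫ x in (-L)..L, u x) atTop (𝓝 (∫ x, u x)) :=
    intervalIntegral_tendsto_integral (i1.sub i2) tendsto_neg_atTop_atBot tendsto_id
  have h0 := tendsto_nhds_unique hT2 hT
  have h1 : ∫ x, u x = Real.pi * psi α β 0 y - c * Real.pi := by
    simp only [u]
    rw [integral_sub i1 i2, integral_indicator measurableSet_bandSet, integral_const_mul,
      integral_const_mul, integral_sub_right_eq_self (fun x : ℝ => (1 + x ^ 2)⁻¹) y,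
      integral_univ_inv_one_add_sq]
    rfl
  rw [h1] at h0
  have h2 : Real.pi * (psi α β 0 y - c) = 0 := by linarith
  rw [hc, sub_eq_zero.1 ((mul_eq_zero.1 h2).resolve_left Real.pi_ne_zero)]

/-- The square of the Stieltjes transform of the weight. -/
lemma Ordered.psi_zero_sq (ho : Ordered α β) {x : ℝ} (hx : 1 < x) :
    psi α β 0 x ^ 2 * ((x ^ 2 - 1) * ∏ j, (x - β j)) = ∏ j, (x - α j) := by
  have h1 := rootFun_sq (α := α) (β := β) (x : ℂ)
  rw [ho.rootFun_eq_psi_zero hx] at h1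
  have h2 : psi α β 0 x ^ 2 = (∏ j, (x - α j)) / ((x ^ 2 - 1) * ∏ j, (x - β j)) := by
    exact_mod_cast h1
  rw [h2, div_mul_cancel₀]
  refine mul_ne_zero (by nlinarith) (Finset.prod_ne_zero_iff.2 fun j _ => ?_)
  linarith [ho.β_lt_one j]

end Stieltjes

/-! ### Consequences of periodicity: Pell equation and Chebyshev form -/

section Period

open Filter Topology

variable {g : ℕ} {α β : Fin g → ℝ} {K : ℕ}

/-- The polynomial `∏ (X - α_j)`. -/
noncomputable def numPoly (α : Fin g → ℝ) : ℝ[X] := ∏ j, (X - C (α j))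

/-- The polynomial `(X² - 1) ∏ (X - β_j)`. -/
noncomputable def denPoly (β : Fin g → ℝ) : ℝ[X] := (X ^ 2 - 1) * ∏ j, (X - C (β j))

@[simp] lemma eval_numPoly (x : ℝ) : (numPoly α).eval x = ∏ j, (x - α j) := by
  simp [numPoly, eval_prod]

@[simp] lemma eval_denPoly (x : ℝ) : (denPoly β).eval x = (x ^ 2 - 1) * ∏ j, (x - β j) := by
  simp [denPoly, eval_prod]

lemma monic_numPoly : (numPoly α).Monic := monic_prod_of_monic _ _ fun _ _ => monic_X_sub_C _

lemma natDegree_numPoly : (numPoly α).natDegree = g := by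
  rw [numPoly, natDegree_prod_of_monic _ _ fun _ _ => monic_X_sub_C _]
  simp

lemma monic_X_sq_sub_one : (X ^ 2 - 1 : ℝ[X]).Monic := by
  have := monic_X_pow_sub_C (1 : ℝ) (two_ne_zero)
  simpa using this

lemma monic_denPoly : (denPoly β).Monic :=
  monic_X_sq_sub_one.mul (monic_prod_of_monic _ _ fun _ _ => monic_X_sub_C _)

lemma natDegree_denPoly : (denPoly β).natDegree = g + 2 := by
  rw [denPoly, monic_X_sq_sub_one.natDegree_mul (monic_prod_of_monic _ _ fun _ _ => monic_X_sub_C _),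
    natDegree_prod_of_monic _ _ fun _ _ => monic_X_sub_C _]
  have : (X ^ 2 - 1 : ℝ[X]).natDegree = 2 := by
    simpa using natDegree_X_pow_sub_C (n := 2) (r := (1 : ℝ))
  rw [this]
  simp [add_comm]

lemma StrictlyOrdered.isCoprime (ho : StrictlyOrdered α β) :
    IsCoprime (numPoly α) (denPoly β) := by
  refine IsCoprime.prod_left fun j _ => ?_
  rw [(irreducible_X_sub_C (α j)).coprime_iff_not_dvd, dvd_iff_isRoot, IsRoot, eval_denPoly]
  refine mul_ne_zero ?_ (Finset.prod_ne_zero_iff.2 fun i _ => ?_)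
  · nlinarith [ho.ordered.neg_one_lt_α j, ho.ordered.α_lt_one j]
  · rcases lt_trichotomy i j with h | rfl | h
    · linarith [ho.ordered.β_lt_α h]
    · linarith [ho.2 i]
    · linarith [ho.ordered.β_lt_α h, ho.2 j, ho.2 i]

/-- `numPoly * denPoly` is not a square. -/
lemma Ordered.eq_zero_of_sq (ho : Ordered α β) {Y B : ℝ[X]}
    (h : Y ^ 2 = B ^ 2 * (numPoly α * denPoly β)) : B = 0 := by
  by_contra hB
  have e : denPoly β = (X - C 1) * ((X + 1) * ∏ j, (X - C (β j))) := by
    rw [denPoly]; simp only [C_1]; ring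
  set D' := (X + 1) * ∏ j, (X - C (β j))
  have hND : ¬ (numPoly α * D').IsRoot 1 := by
    simp only [IsRoot, eval_mul, eval_numPoly, D', eval_add, eval_X, eval_one, eval_prod, eval_sub,
      eval_C]
    refine mul_ne_zero (Finset.prod_ne_zero_iff.2 fun j _ => ?_)
      (mul_ne_zero (by norm_num) (Finset.prod_ne_zero_iff.2 fun j _ => ?_))
    · linarith [ho.α_lt_one j]
    · linarith [ho.β_lt_one j]
  have hND0 : numPoly α * D' ≠ 0 := by rintro h; exact hND (by rw [h]; simp)
  have h1 : Y ^ 2 = B ^ 2 * ((X - C 1) * (numPoly α * D')) := by rw [h, e]; ring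
  have hne : B ^ 2 * ((X - C 1) * (numPoly α * D')) ≠ 0 :=
    mul_ne_zero (pow_ne_zero _ hB) (mul_ne_zero (X_sub_C_ne_zero 1) hND0)
  -- The point 1 is a simple zero of D and no zero of N, so its multiplicity is even on the left and
  -- odd on the right.
  have h2 := congrArg (rootMultiplicity 1) h1
  rw [rootMultiplicity_mul hne, rootMultiplicity_mul (mul_ne_zero (X_sub_C_ne_zero 1) hND0),
    rootMultiplicity_X_sub_C_self, rootMultiplicity_eq_zero hND] at h2
  have hY : Y ^ 2 ≠ 0 := h1 ▸ hne
  rw [sq Y, sq B, rootMultiplicity_mul (by rwa [← sq]),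
    rootMultiplicity_mul (mul_ne_zero hB hB)] at h2
  omega

lemma HasPeriod.recA_mul_add (hper : HasPeriod α β K) (m : ℕ) {n : ℕ} (hn : 2 ≤ n) :
    recA α β (n + m * K) = recA α β n := by
  induction m with
  | zero => simp
  | succ m ih =>
    rw [← ih, ← hper.2 (n + m * K) (by omega)]
    congr 1; ring

/-- The ratios of consecutive h_n are the a_n, periodic from a_2 on; hence the start at h_1 rather
than h_0. -/
lemma HasPeriod.h_add (hper : HasPeriod α β K) (ho : StrictlyOrdered α β) (n : ℕ) :
    h α β (n + 1 + K) = h α β (1 + K) / h α β 1 * h α β (n + 1) := by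
  induction n with
  | zero => rw [zero_add, div_mul_cancel₀ _ (h_pos ho 1).ne']
  | succ n ih =>
    have e := h_succ ho (n + 1 + K)
    have e2 := hper.2 (n + 1 + 1) (by omega)
    rw [show n + 1 + K + 1 = n + 1 + 1 + K by ring, e2, ih] at e
    rw [e, h_succ ho (n + 1)]
    ring

/-- By periodicity, the functions of the second kind shifted by a period are proportional to the
original ones. -/
lemma HasPeriod.psi_rel (hper : HasPeriod α β K) (ho : StrictlyOrdered α β) (hK : 1 ≤ K)
    {x : ℝ} (hx : 1 < x) :
    recA α β (K + 1) * (psi α β K x * psi α β 1 x) =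
      recA α β 1 * (psi α β 0 x * psi α β (K + 1) x) := by
  -- The Casoratian of ψ and its shift by a period. It starts at index 1 because a_1 is exempt from
  -- periodicity.
  set W : ℕ → ℝ := fun n => psi α β (n + 1 + K) x * psi α β (n + 2) x -
    psi α β (n + 2 + K) x * psi α β (n + 1) x with hW
  have hstep : ∀ n, W (n + 1) = recA α β (n + 2) * W n := by
    intro n
    have e1 := psi_add_two ho (n + 1) hx
    have e2 := psi_add_two ho (n + 1 + K) hx
    have hb := hper.1 (n + 1 + 2) (by omega)
    have ha := hper.2 (n + 1 + 1) (by omega)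
    rw [show n + 1 + K + 2 = n + 1 + 2 + K by ring, show n + 1 + K + 1 = n + 1 + 1 + K by ring,
      hb, ha] at e2
    simp only [hW]
    rw [e1, e2, show n + 1 + 1 = n + 2 by ring]
    ring
  have hWn : ∀ n, W n = h α β (n + 1) / h α β 1 * W 0 := by
    intro n
    induction n with
    | zero => rw [zero_add, div_self (h_pos ho 1).ne', one_mul]
    | succ n ih => rw [hstep, ih, h_succ ho (n + 1)]; ring
  have hr0 : 0 ≤ 1 / x := by positivity
  have hr1 : 1 / x < 1 := by rw [div_lt_one (by linarith)]; exact hx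
  set c := (1 + h α β 0) / (2 * (x - 1))
  have hc : 0 ≤ c := div_nonneg (by linarith [h_pos ho 0]) (by linarith)
  set ρ := h α β (1 + K) / h α β 1
  have hρ : 0 ≤ ρ := (div_pos (h_pos ho _) (h_pos ho _)).le
  set a := recA α β 2
  have ha0 : 0 ≤ a := (recA_pos ho 2).le
  -- At index mK both W and the bound on the products of ψ's are proportional to h_{mK+1}. It
  -- cancels, so its growth or decay is irrelevant and only the geometric factor remains.
  have hbound : ∀ m : ℕ, |W 0| ≤ 2 * (√ρ * √a * c ^ 2) * h α β 1 * (1 / x) ^ m := by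
    intro m
    set v := h α β (m * K + 1)
    have hv : 0 < v := h_pos ho _
    have e1 : h α β (m * K + 2) = a * v := by
      rw [h_succ ho (m * K + 1), show m * K + 1 + 1 = 2 + m * K by ring, hper.recA_mul_add m le_rfl]
    have e2 : h α β (m * K + 1 + K) = ρ * v := hper.h_add ho (m * K)
    have e3 : h α β (m * K + 2 + K) = ρ * (a * v) := by
      rw [← e1]; exact hper.h_add ho (m * K + 1)
    have b1 := abs_psi_le ho (m * K + 1 + K) hx
    have b2 := abs_psi_le ho (m * K + 2) hx
    have b3 := abs_psi_le ho (m * K + 2 + K) hx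
    have b4 := abs_psi_le ho (m * K + 1) hx
    rw [e2, Real.sqrt_mul hρ] at b1
    rw [e1, Real.sqrt_mul ha0] at b2
    rw [e3, Real.sqrt_mul hρ, Real.sqrt_mul ha0] at b3
    have hvv : √v * √v = v := Real.mul_self_sqrt hv.le
    have hp : (1 / x) ^ (2 * (m * K) + K + 3) ≤ (1 / x) ^ m := by
      refine pow_le_pow_of_le_one hr0 hr1.le ?_
      nlinarith
    have hWm : |W (m * K)| ≤ 2 * (√ρ * √a * c ^ 2) * v * (1 / x) ^ m := by
      simp only [hW]
      refine (abs_sub _ _).trans ?_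
      rw [abs_mul, abs_mul]
      calc _ ≤ (√ρ * √v * c * (1 / x) ^ (m * K + 1 + K)) * (√a * √v * c * (1 / x) ^ (m * K + 2)) +
            (√ρ * (√a * √v) * c * (1 / x) ^ (m * K + 2 + K)) * (√v * c * (1 / x) ^ (m * K + 1)) := by
            gcongr
        _ = 2 * (√ρ * √a * c ^ 2) * (√v * √v) * (1 / x) ^ (2 * (m * K) + K + 3) := by ring
        _ ≤ _ := by rw [hvv]; gcongr
    rw [hWn, abs_mul, abs_of_pos (div_pos hv (h_pos ho 1)), div_mul_eq_mul_div,
      div_le_iff₀ (h_pos ho 1)] at hWm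
    refine le_of_mul_le_mul_left (hWm.trans_eq ?_) hv
    ring
  have hlim : Tendsto (fun m : ℕ => 2 * (√ρ * √a * c ^ 2) * h α β 1 * (1 / x) ^ m) atTop (𝓝 0) := by
    simpa using (tendsto_pow_atTop_nhds_zero_of_lt_one hr0 hr1).const_mul
      (2 * (√ρ * √a * c ^ 2) * h α β 1)
  have hW0 : W 0 = 0 := abs_nonpos_iff.1 (ge_of_tendsto' hlim hbound)
  -- One step back to index 0, where a_1 and a_{K+1} need not agree; each sequence keeps its own
  -- coefficient.
  have e1 := psi_add_two ho 0 hx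
  have e2 := psi_add_two ho K hx
  have hb := hper.1 2 (by omega)
  rw [show K + 2 = 2 + K by ring, hb] at e2
  simp only [hW, zero_add] at hW0 e1
  rw [e1, e2, show 1 + K = K + 1 by ring] at hW0
  linear_combination hW0

lemma exists_secondPoly_succ (α β : Fin g → ℝ) (n : ℕ) :
    ∃ q : ℝ[X], q.Monic ∧ q.natDegree = n ∧ secondPoly α β (n + 1) = C (h α β 0) * q := by
  induction n using Nat.twoStepInduction with
  | zero => exact ⟨1, monic_one, by simp, by simp⟩
  | one => exact ⟨X - C (recB α β 2), monic_X_sub_C _, by simp, by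
      rw [secondPoly_add_two]; simp [mul_comm]⟩
  | more n ih1 ih2 =>
    obtain ⟨q, hq, hqn, hqe⟩ := ih1
    obtain ⟨r, hr, hrn, hre⟩ := ih2
    have hm := (monic_X_sub_C (recB α β (n + 1 + 2))).mul hr
    have hmn : ((X - C (recB α β (n + 1 + 2))) * r).natDegree = n + 2 := by
      rw [(monic_X_sub_C _).natDegree_mul hr, hrn, natDegree_X_sub_C]; ring
    have hlt : (C (recA α β (n + 1 + 1)) * q).degree <
        ((X - C (recB α β (n + 1 + 2))) * r).degree := by
      refine (degree_C_mul_le _ _).trans_lt ?_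
      rw [degree_eq_natDegree hq.ne_zero, degree_eq_natDegree hm.ne_zero, hmn, hqn]
      exact_mod_cast (by omega)
    refine ⟨_, hm.sub_of_left hlt, ?_, ?_⟩
    · exact (natDegree_eq_of_degree_eq (degree_sub_eq_left_of_degree_lt hlt)).trans hmn
    · rw [show n + 2 + 1 = n + 1 + 2 by ring, secondPoly_add_two, hqe, hre]
      ring

/-- The algebraic consequences of periodicity. The polynomial `S` has the closed gaps as zeros. -/
structure PellData (α β : Fin g → ℝ) (K : ℕ) (S : ℝ[X]) : Prop where
  monic : S.Monic
  natDegree : g + S.natDegree + 1 = K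
  h_zero : h α β 0 = 1
  recA_one : recA α β 1 = 2 * recA α β (K + 1)
  secondPoly_eq : secondPoly α β K = numPoly α * S
  two_mul_P : 2 * P α β (K + 1) = P α β K * P α β 1 + denPoly β * S
  two_mul_secondPoly : 2 * secondPoly α β (K + 1) = P α β K + secondPoly α β K * P α β 1
  pell : P α β K ^ 2 = C (Δ α β K ^ 2) + denPoly β * numPoly α * S ^ 2

/-- The Casoratian relation reads A ψ_0² - B ψ_0 + a_{K+1} h_0 Q_K = 0. Multiplied by D it becomes Y
= B ψ_0 D with Y a polynomial; squaring gives Y² = B² N D, hence B = 0 and Y = 0. From B = 0 come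
a_1 = 2a_{K+1} and the formula for Q_{K+1}; from Y = 0 and the coprimality of N and D come N ∣ Q_K
and the formula for P_{K+1}. The determinant identity for P and Q then turns into the Pell equation.
-/
lemma HasPeriod.exists_pellData (hper : HasPeriod α β K) (ho : StrictlyOrdered α β) (hK : 1 ≤ K) :
    ∃ S, PellData α β K S := by
  set a := recA α β 1
  set a' := recA α β (K + 1)
  set h0 := h α β 0
  have ha' : 0 < a' := recA_pos ho _
  have hh0 : 0 < h0 := h_pos ho 0
  set Q1 := secondPoly α β (K + 1)
  set Q0 := secondPoly α β K
  set A := C a' * P α β K * P α β 1 - C a * P α β (K + 1)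
  set B := C a' * (C h0 * P α β K + Q0 * P α β 1) - C a * Q1 with hB
  set Y := A * numPoly α + C (a' * h0) * Q0 * denPoly β with hY
  have hquad : ∀ x : ℝ, 1 < x → Y.eval x = B.eval x * (psi α β 0 x * (denPoly β).eval x) := by
    intro x hx
    have h1 := hper.psi_rel ho hK hx
    have h2 := ho.ordered.psi_zero_sq hx
    rw [psi_eq ho K hx, psi_eq ho 1 hx, psi_eq ho (K + 1) hx, secondPoly_one, eval_C] at h1
    rw [← eval_denPoly, ← eval_numPoly] at h2
    simp only [hY, hB, A, eval_add, eval_sub, eval_mul, eval_C]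
    rw [← h2]
    linear_combination (denPoly β).eval x * h1
  have hsq : Y ^ 2 = B ^ 2 * (numPoly α * denPoly β) := by
    refine eq_of_infinite_eval_eq _ _ ((Set.Ioi_infinite (1 : ℝ)).mono fun x hx => ?_)
    have h2 := ho.ordered.psi_zero_sq hx
    rw [← eval_denPoly, ← eval_numPoly] at h2
    simp only [Set.mem_ofPred_eq, eval_pow, eval_mul]
    rw [hquad x hx, ← h2]
    ring
  have hB0 : B = 0 := ho.ordered.eq_zero_of_sq hsq
  have hY0 : Y = 0 := by
    rw [hB0] at hsq
    exact pow_eq_zero_iff (two_ne_zero) |>.1 (by rw [hsq]; ring)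
  obtain ⟨k, rfl⟩ : ∃ k, K = k + 1 := ⟨K - 1, by omega⟩
  obtain ⟨q, hq, hqn, hqe⟩ := exists_secondPoly_succ α β k
  obtain ⟨r, hr, hrn, hre⟩ := exists_secondPoly_succ α β (k + 1)
  have hQ0 : Q0 = C h0 * q := hqe
  have hQ1 : Q1 = C h0 * r := hre
  have hC0 : (C h0 : ℝ[X]) ≠ 0 := C_ne_zero.2 hh0.ne'
  have hrel : C a' * (P α β (k + 1) + q * P α β 1) = C a * r := by
    refine mul_left_cancel₀ hC0 ?_
    rw [hB, hQ0, hQ1] at hB0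
    linear_combination hB0
  -- Leading coefficients in B = 0: two monic polynomials on the left, one on the right.
  have haa : a = 2 * a' := by
    have hqP : (q * P α β 1).Monic := hq.mul (monic_P 1)
    have hqPn : (q * P α β 1).natDegree = k + 1 := by
      rw [hq.natDegree_mul (monic_P 1), hqn, natDegree_P]
    have c1 : (P α β (k + 1)).coeff (k + 1) = 1 := by
      have := (monic_P (α := α) (β := β) (k + 1)).coeff_natDegree
      rwa [natDegree_P] at this
    have c2 : (q * P α β 1).coeff (k + 1) = 1 := by
      have := hqP.coeff_natDegree; rwa [hqPn] at this
    have c3 : r.coeff (k + 1) = 1 := by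
      have := hr.coeff_natDegree; rwa [hrn] at this
    have := congrArg (fun p => p.coeff (k + 1)) hrel
    simp only [coeff_C_mul, coeff_add, c1, c2, c3] at this
    linarith
  have hCa' : (C a' : ℝ[X]) ≠ 0 := C_ne_zero.2 ha'.ne'
  have hrel2 : P α β (k + 1) + q * P α β 1 = 2 * r := by
    refine mul_left_cancel₀ hCa' ?_
    rw [hrel, haa, C_mul, show (C 2 : ℝ[X]) = 2 from rfl]
    ring
  set M := 2 * P α β (k + 1 + 1) - P α β (k + 1) * P α β 1 with hM
  have hMN : M * numPoly α = C (h0 ^ 2) * (q * denPoly β) := by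
    refine mul_left_cancel₀ hCa' ?_
    have : Y = C a' * (C (h0 ^ 2) * (q * denPoly β) - M * numPoly α) := by
      simp only [hY, A, haa, hQ0, hM, C_mul, C_pow]
      rw [show (C 2 : ℝ[X]) = 2 from rfl]
      ring
    rw [this] at hY0
    linear_combination -hY0
  have hMm : M.coeff (k + 2) = 1 := by
    have hP1 : (P α β (k + 1) * P α β 1).natDegree = k + 2 := by
      rw [(monic_P _).natDegree_mul (monic_P 1), natDegree_P, natDegree_P]
    have c1 : (P α β (k + 1) * P α β 1).coeff (k + 2) = 1 := by
      have := ((monic_P (α := α) (β := β) (k + 1)).mul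
        (monic_P (α := α) (β := β) 1)).coeff_natDegree
      rwa [hP1] at this
    have c2 : (P α β (k + 1 + 1)).coeff (k + 2) = 1 := by
      have := (monic_P (α := α) (β := β) (k + 1 + 1)).coeff_natDegree
      rwa [natDegree_P] at this
    rw [hM, coeff_sub, c1, ← C_ofNat 2, coeff_C_mul, c2]
    norm_num
  obtain ⟨S, hS⟩ : numPoly α ∣ q := by
    have : numPoly α ∣ q * denPoly β := by
      rw [← (isUnit_C.2 (isUnit_iff_ne_zero.2 (pow_ne_zero 2 hh0.ne'))).dvd_mul_left, ← hMN]
      exact dvd_mul_left _ _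
    exact ho.isCoprime.dvd_of_dvd_mul_right this
  have hSm : S.Monic := monic_numPoly.of_mul_monic_left (hS ▸ hq)
  have hSn : g + S.natDegree = k := by
    rw [← hqn, hS, monic_numPoly.natDegree_mul hSm, natDegree_numPoly]
  have hMS : M = C (h0 ^ 2) * (denPoly β * S) := by
    refine mul_right_cancel₀ (monic_numPoly (α := α)).ne_zero ?_
    rw [hMN, hS]; ring
  -- The coefficient of degree K + 1 in M = h_0² D S gives 1 = h_0².
  have hh1 : h0 = 1 := by
    have hDS : (denPoly β * S).Monic := monic_denPoly.mul hSm
    have hDSn : (denPoly β * S).natDegree = k + 2 := by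
      rw [monic_denPoly.natDegree_mul hSm, natDegree_denPoly]; omega
    rw [hMS, coeff_C_mul, ← hDSn, hDS.coeff_natDegree, mul_one] at hMm
    nlinarith
  rw [hh1] at hMS hQ0 hQ1
  simp only [one_pow, C_1, one_mul] at hMS hQ0 hQ1
  have t1 : 2 * P α β (k + 1 + 1) = P α β (k + 1) * P α β 1 + denPoly β * S := by
    rw [← hMS, hM]; ring
  have t2 : 2 * Q1 = P α β (k + 1) + Q0 * P α β 1 := by
    rw [hQ1, ← hrel2, hQ0]
  have t3 : Q0 = numPoly α * S := by rw [hQ0, hS]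
  refine ⟨S, hSm, by omega, hh1, haa, t3, t1, t2, ?_⟩
  have hdet : P α β (k + 1) * Q1 - P α β (k + 1 + 1) * Q0 = C (h α β (k + 1)) :=
    P_mul_secondPoly_sub ho (k + 1)
  have hΔ : (C (Δ α β (k + 1) ^ 2) : ℝ[X]) = 2 * C (h α β (k + 1)) := by
    rw [Δ, Real.sq_sqrt (by linarith [h_pos ho (k + 1)]), C_mul]; rfl
  rw [hΔ, ← hdet]
  linear_combination -(P α β (k + 1)) * t2 + Q0 * t1 + denPoly β * S * t3

variable {S : ℝ[X]}

lemma PellData.one_le (hS : PellData α β K S) : 1 ≤ K := by have := hS.natDegree; omega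

/-- Shift of the polynomials by a period. -/
lemma PellData.shift (hS : PellData α β K S) (ho : StrictlyOrdered α β) (hper : HasPeriod α β K)
    (n : ℕ) :
    2 * P α β (n + 1 + K) = P α β K * P α β (n + 1) + denPoly β * S * secondPoly α β (n + 1) ∧
      2 * secondPoly α β (n + 1 + K) =
        secondPoly α β K * P α β (n + 1) + P α β K * secondPoly α β (n + 1) := by
  have h1 := hS.two_mul_P
  have h2 := hS.two_mul_secondPoly
  induction n using Nat.twoStepInduction with
  | zero =>
    rw [show 0 + 1 + K = K + 1 by ring, zero_add, secondPoly_one, hS.h_zero, C_1]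
    exact ⟨by rw [h1]; ring, by rw [h2]; ring⟩
  -- A second base case is needed because the formula fails at index 0, where it would say 2P_K =
  -- P_K. The factor 2 in a_1 = 2a_{K+1} compensates exactly.
  | one =>
    have hb := hper.1 2 (by omega)
    have ha : (C (recA α β 1) : ℝ[X]) = 2 * C (recA α β (K + 1)) := by
      rw [hS.recA_one, C_mul]; rfl
    rw [show 1 + 1 + K = K + 2 by ring, P_add_two ho, secondPoly_add_two, show 1 + 1 = 0 + 2 by ring,
      P_add_two ho, secondPoly_add_two, show K + 2 = 2 + K by ring, hb]
    simp only [zero_add, secondPoly_one, hS.h_zero, C_1, secondPoly_zero, P_zero, ha]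
    constructor
    · linear_combination (X - C (recB α β 2)) * h1
    · linear_combination (X - C (recB α β 2)) * h2
  | more n ih1 ih2 =>
    have hb := hper.1 (n + 1 + 2) (by omega)
    have ha := hper.2 (n + 2) (by omega)
    have e1 := P_add_two ho (n + 1 + K)
    have e2 := secondPoly_add_two (α := α) (β := β) (n + 1 + K)
    have e3 := P_add_two ho (n + 1)
    have e4 := secondPoly_add_two (α := α) (β := β) (n + 1)
    rw [show n + 1 + K + 2 = n + 1 + 2 + K by ring, hb, show n + 1 + K + 1 = n + 2 + K by ring, ha]
      at e1 e2
    rw [show n + 1 + 1 + K = n + 2 + K by ring] at ih2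
    rw [show n + 2 + 1 = n + 1 + 2 by ring, e1, e2, e3, e4]
    constructor
    · linear_combination (X - C (recB α β (n + 1 + 2))) * ih2.1 - C (recA α β (n + 2)) * ih1.1
    · linear_combination (X - C (recB α β (n + 1 + 2))) * ih2.2 - C (recA α β (n + 2)) * ih1.2

lemma Δ_pos (ho : StrictlyOrdered α β) (K : ℕ) : 0 < Δ α β K :=
  Real.sqrt_pos.2 (by linarith [h_pos ho K])

/-- The polynomial `P_K / Δ_K`. -/
noncomputable def normPoly (α β : Fin g → ℝ) (K : ℕ) : ℝ[X] := C (Δ α β K)⁻¹ * P α β K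

lemma P_eq_normPoly (ho : StrictlyOrdered α β) (K : ℕ) :
    P α β K = C (Δ α β K) * normPoly α β K := by
  rw [normPoly, ← mul_assoc, ← C_mul, mul_inv_cancel₀ (Δ_pos ho K).ne', C_1, one_mul]

/-- By Pell, D S Q_K = Δ²(p² - 1). With this the period shift becomes T_{n+2} = X T_{n+1} - (1 - X²)
U_n and U_{n+1} = X U_n + T_{n+1}, composed with p; the powers of 2 collect the factor 2 of each
shift. -/
lemma PellData.chebyshev (hS : PellData α β K S) (ho : StrictlyOrdered α β)
    (hper : HasPeriod α β K) (n : ℕ) :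
    P α β ((n + 1) * K) =
        C (Δ α β K ^ (n + 1) * (2 ^ n)⁻¹) * (Chebyshev.T ℝ (n + 1)).comp (normPoly α β K) ∧
      secondPoly α β ((n + 1) * K) =
        C (Δ α β K ^ n * (2 ^ n)⁻¹) * secondPoly α β K *
          (Chebyshev.U ℝ n).comp (normPoly α β K) := by
  set p := normPoly α β K
  have hP : P α β K = C (Δ α β K) * p := P_eq_normPoly ho K
  induction n with
  | zero => simp [hP]
  | succ n ih =>
    obtain ⟨m, hm⟩ : ∃ m, (n + 1) * K = m + 1 :=
      Nat.exists_eq_add_one.2 (Nat.mul_pos n.succ_pos hS.one_le)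
    have hs := hS.shift ho hper m
    rw [← hm, show (n + 1) * K + K = (n + 1 + 1) * K by ring, ih.1, ih.2, hP] at hs
    have hpell : denPoly β * S * secondPoly α β K = C (Δ α β K ^ 2) * (p ^ 2 - 1) := by
      have := hS.pell
      rw [hP] at this
      rw [hS.secondPoly_eq, C_pow] at *
      linear_combination -this
    have hT : (Chebyshev.T ℝ ((n : ℤ) + 2)).comp p =
        p * (Chebyshev.T ℝ ((n : ℤ) + 1)).comp p -
          (1 - p ^ 2) * (Chebyshev.U ℝ n).comp p := by
      rw [Chebyshev.T_eq_X_mul_T_sub_pol_U]; simp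
    have hU : (Chebyshev.U ℝ ((n : ℤ) + 1)).comp p =
        p * (Chebyshev.U ℝ n).comp p + (Chebyshev.T ℝ ((n : ℤ) + 1)).comp p := by
      rw [Chebyshev.U_eq_X_mul_U_add_T]; simp
    have h2 : (2 : ℝ[X]) ≠ 0 := two_ne_zero
    have hc : (2 : ℝ[X]) * C ((2 ^ (n + 1) : ℝ)⁻¹) = C ((2 ^ n : ℝ)⁻¹) := by
      rw [show (2 : ℝ[X]) = C 2 from rfl, ← C_mul, pow_succ]
      congr 1
      field_simp
    push_cast
    rw [show (n : ℤ) + 1 + 1 = n + 2 by ring, hT, hU]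
    constructor
    · refine mul_left_cancel₀ h2 ?_
      rw [hs.1]
      simp only [C_mul, C_pow] at hpell ⊢
      linear_combination C (Δ α β K) ^ n * C ((2 ^ n : ℝ)⁻¹) * (Chebyshev.U ℝ n).comp p * hpell -
        C (Δ α β K) ^ (n + 2) * (p * (Chebyshev.T ℝ ((n : ℤ) + 1)).comp p -
          (1 - p ^ 2) * (Chebyshev.U ℝ n).comp p) * hc
    · refine mul_left_cancel₀ h2 ?_
      rw [hs.2]
      simp only [C_mul, C_pow]
      linear_combination - C (Δ α β K) ^ (n + 1) * secondPoly α β K *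
        (p * (Chebyshev.U ℝ n).comp p + (Chebyshev.T ℝ ((n : ℤ) + 1)).comp p) * hc

lemma PellData.P_mul (hS : PellData α β K S) (ho : StrictlyOrdered α β)
    (hper : HasPeriod α β K) (n : ℕ) :
    P α β (n * K) = C (Δ α β K ^ n) * (monicT n).comp (normPoly α β K) := by
  cases n with
  -- The truncated exponent n - 1 is 0 here, as T_0 = 1 requires.
  | zero => simp [monicT]
  | succ n =>
    rw [(hS.chebyshev ho hper n).1, monicT]
    simp only [mul_comp, C_comp, Nat.add_sub_cancel, C_mul]
    push_cast
    ring

end Period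

/-! ### Counting zeros, critical points, monotone pieces -/

section Roots

lemma aeval_ofReal_eq_zero (q : ℝ[X]) (x : ℝ) : aeval (x : ℂ) q = 0 ↔ q.eval x = 0 := by
  rw [← Complex.coe_algebraMap, aeval_algebraMap_apply, map_eq_zero, coe_aeval_eq_eval]

/-- A real polynomial with as many real zeros as its degree has no other complex zeros. -/
lemma exists_mem_of_aeval_eq_zero {q : ℝ[X]} (hq : q ≠ 0) {s : Finset ℝ}
    (hs : ∀ x ∈ s, q.eval x = 0) (hcard : q.natDegree ≤ s.card) {z : ℂ} (hz : aeval z q = 0) :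
    ∃ x ∈ s, z = (x : ℂ) := by
  have hsplit : q.roots = s.val := by
    have hle : s.val ≤ q.roots := by
      rw [Multiset.le_iff_subset s.nodup]
      exact fun x hx => (mem_roots hq).2 (hs x hx)
    exact (Multiset.eq_of_le_of_card_le hle ((card_roots' q).trans hcard)).symm
  have hsp : q.Splits := by
    rw [splits_iff_card_roots]
    exact le_antisymm (card_roots' q) (by rw [hsplit]; exact hcard)
  have hmem : z ∈ (q.map (algebraMap ℝ ℂ)).roots := by
    rw [mem_roots (map_ne_zero hq), IsRoot, eval_map_algebraMap]; exact hz
  rw [hsp.roots_map, hsplit, Multiset.mem_map] at hmem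
  obtain ⟨x, hx, rfl⟩ := hmem
  exact ⟨x, hx, rfl⟩

lemma exists_mem_of_eval_eq_zero {q : ℝ[X]} (hq : q ≠ 0) {s : Finset ℝ}
    (hs : ∀ x ∈ s, q.eval x = 0) (hcard : q.natDegree ≤ s.card) {z : ℝ} (hz : q.eval z = 0) :
    z ∈ s := by
  obtain ⟨x, hx, h⟩ := exists_mem_of_aeval_eq_zero hq hs hcard (z := z)
    ((aeval_ofReal_eq_zero q z).2 hz)
  rwa [Complex.ofReal_inj.1 h]

lemma exists_derivative_eq_zero (q : ℝ[X]) {a b : ℝ} (hab : a < b) (h : q.eval a = q.eval b) :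
    ∃ c ∈ Set.Ioo a b, q.derivative.eval c = 0 := by
  obtain ⟨c, hc, h0⟩ := exists_deriv_eq_zero hab q.continuous.continuousOn h
  exact ⟨c, hc, by rwa [q.deriv] at h0⟩

lemma derivative_ne_zero_of_natDegree {q : ℝ[X]} {k : ℕ} (hdeg : q.natDegree = k + 1) :
    q.derivative ≠ 0 := by
  intro h
  have := derivative_eq_zero.1 h
  omega

/-- The critical points of a polynomial with simple real zeros interlace with the zeros. -/
lemma exists_critical_points {q : ℝ[X]} {k : ℕ} (hdeg : q.natDegree = k + 1)
    {x : Fin (k + 1) → ℝ} (hx : StrictMono x) (hroot : ∀ i, q.eval (x i) = 0) :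
    ∃ y : Fin k → ℝ, StrictMono y ∧ (∀ i, x i.castSucc < y i ∧ y i < x i.succ) ∧
      (∀ i, q.derivative.eval (y i) = 0) ∧
      ∀ z : ℂ, aeval z q.derivative = 0 → ∃ i, z = (y i : ℂ) := by
  have h1 : ∀ i : Fin k, ∃ y ∈ Set.Ioo (x i.castSucc) (x i.succ), q.derivative.eval y = 0 :=
    fun i => exists_derivative_eq_zero q (hx i.castSucc_lt_succ) (by rw [hroot, hroot])
  choose y hy hy0 using h1
  have hmono : StrictMono y := fun i j hij =>
    (hy i).2.trans_le ((hx.monotone (show i.succ ≤ j.castSucc from hij)).trans (hy j).1.le)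
  refine ⟨y, hmono, hy, hy0, fun z hz => ?_⟩
  obtain ⟨t, ht, rfl⟩ := exists_mem_of_aeval_eq_zero (s := Finset.univ.image y)
    (derivative_ne_zero_of_natDegree hdeg) (by simpa using hy0)
    (by
      rw [Finset.card_image_of_injective _ hmono.injective, Finset.card_univ, Fintype.card_fin]
      exact (natDegree_derivative_le q).trans (by omega)) hz
  obtain ⟨i, -, rfl⟩ := Finset.mem_image.1 ht
  exact ⟨i, rfl⟩

/-- An injective continuous function on an interval that is `±1` at the end points. -/
lemma bijOn_Icc_of_injOn {f : ℝ → ℝ} {l r : ℝ} (hlr : l < r) (hc : ContinuousOn f (Set.Icc l r))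
    (hi : Set.InjOn f (Set.Icc l r)) (hl : f l ^ 2 = 1) (hr : f r ^ 2 = 1) :
    Set.BijOn f (Set.Icc l r) (Set.Icc (-1) 1) := by
  have hml : l ∈ Set.Icc l r := Set.left_mem_Icc.2 hlr.le
  have hmr : r ∈ Set.Icc l r := Set.right_mem_Icc.2 hlr.le
  have hne : f l ≠ f r := fun h => hlr.ne (hi hml hmr h)
  rcases hc.strictMonoOn_of_injOn_Icc' hlr.le hi with hm | hm
  · have h1 := hm hml hmr hlr
    have h2 : f l = -1 := by
      rcases sq_eq_one_iff.1 hl with h | h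
      · nlinarith
      · exact h
    have h3 : f r = 1 := by
      rcases sq_eq_one_iff.1 hr with h | h
      · exact h
      · linarith
    refine ⟨fun x hx => ⟨?_, ?_⟩, hi, fun c hcc => ?_⟩
    · rw [← h2]; exact hm.monotoneOn hml hx hx.1
    · rw [← h3]; exact hm.monotoneOn hx hmr hx.2
    · exact intermediate_value_Icc hlr.le hc (by rwa [h2, h3])
  · have h1 := hm hml hmr hlr
    have h2 : f l = 1 := by
      rcases sq_eq_one_iff.1 hl with h | h
      · exact h
      · nlinarith
    have h3 : f r = -1 := by
      rcases sq_eq_one_iff.1 hr with h | h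
      · linarith
      · exact h
    refine ⟨fun x hx => ⟨?_, ?_⟩, hi, fun c hcc => ?_⟩
    · rw [← h3]; exact hm.antitoneOn hx hmr hx.2
    · rw [← h2]; exact hm.antitoneOn hml hx hx.1
    · exact intermediate_value_Icc' hlr.le hc (by rwa [h2, h3])

end Roots

/-! ### Open and closed gaps from the critical points -/

section Gaps

variable {g k : ℕ} {α β : Fin g → ℝ} {S : ℝ[X]}

lemma Ordered.right_le_left (ho : Ordered α β) {i j : Fin (g + 1)} (hij : i < j) :
    bandRight α i ≤ bandLeft β j := by
  obtain ⟨m, rfl⟩ : ∃ m : Fin g, i = m.castSucc :=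
    ⟨i.castPred (Fin.ne_last_of_lt hij), by simp⟩
  rw [bandRight_castSucc]
  refine (ho.2 m).trans ?_
  simpa using ho.strictMono_left.monotone (show m.succ ≤ j from hij)

lemma Ordered.lt_or_gt_of_mem_Ioo (ho : Ordered α β) {i : Fin (g + 1)} {x : ℝ}
    (hx : x ∈ Set.Ioo (bandLeft β i) (bandRight α i)) (j : Fin g) : x < α j ∨ β j < x := by
  rcases le_or_gt i j.castSucc with h | h
  · left
    simpa using hx.2.trans_le (ho.strictMono_right.monotone h)
  · right
    have h' : j.succ ≤ i := h
    simpa using (ho.strictMono_left.monotone h').trans_lt hx.1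

lemma Ordered.mul_nonneg_of_notMem (ho : Ordered α β) {x : ℝ} {j : Fin g}
    (h : x ≤ α j ∨ β j ≤ x) : 0 ≤ (x - α j) * (x - β j) := by
  have := ho.2 j
  rcases h with h | h <;> nlinarith

lemma Ordered.eval_nonneg_of_mem_gap (ho : Ordered α β) {x : ℝ} {j : Fin g}
    (hx : x ∈ Set.Icc (α j) (β j)) : 0 ≤ (denPoly β).eval x * (numPoly α).eval x := by
  have e : (denPoly β).eval x * (numPoly α).eval x =
      (x ^ 2 - 1) * ∏ i, (x - α i) * (x - β i) := by
    rw [eval_denPoly, eval_numPoly, Finset.prod_mul_distrib]; ring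
  rw [e, ← Finset.mul_prod_erase _ _ (Finset.mem_univ j), ← mul_assoc]
  have h1 := ho.neg_one_lt_α j
  have h2 := ho.β_lt_one j
  refine mul_nonneg (mul_nonneg_of_nonpos_of_nonpos ?_ ?_) (Finset.prod_nonneg fun i hi =>
    ho.mul_nonneg_of_notMem ?_)
  · nlinarith [hx.1, hx.2]
  · nlinarith [hx.1, hx.2]
  · rcases lt_or_gt_of_ne (Finset.ne_of_mem_erase hi) with h | h
    · right; linarith [ho.β_lt_α h, hx.1]
    · left; linarith [ho.β_lt_α h, hx.2]

lemma Ordered.eval_nonneg_of_one_le_sq (ho : Ordered α β) {x : ℝ} (hx : 1 ≤ x ^ 2) :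
    0 ≤ (denPoly β).eval x * (numPoly α).eval x := by
  have e : (denPoly β).eval x * (numPoly α).eval x =
      (x ^ 2 - 1) * ∏ i, (x - α i) * (x - β i) := by
    rw [eval_denPoly, eval_numPoly, Finset.prod_mul_distrib]; ring
  rw [e]
  refine mul_nonneg (by linarith) (Finset.prod_nonneg fun i _ => ho.mul_nonneg_of_notMem ?_)
  have h1 := ho.neg_one_lt_α i
  have h2 := ho.β_lt_one i
  rcases le_or_gt x (α i) with h | h
  · exact Or.inl h
  · right; nlinarith

lemma natDegree_normPoly (ho : StrictlyOrdered α β) (K : ℕ) :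
    (normPoly α β K).natDegree = K := by
  rw [normPoly, natDegree_C_mul (inv_ne_zero (Δ_pos ho K).ne'), natDegree_P]

lemma eval_normPoly (K : ℕ) (x : ℝ) :
    (normPoly α β K).eval x = (P α β K).eval x / Δ α β K := by
  rw [normPoly, eval_mul, eval_C, inv_mul_eq_div]

lemma PellData.normPoly_sq {K : ℕ} (hS : PellData α β K S) (ho : StrictlyOrdered α β) :
    normPoly α β K ^ 2 = 1 + C ((Δ α β K)⁻¹ ^ 2) * (denPoly β * numPoly α) * S ^ 2 := by
  have h1 : C ((Δ α β K)⁻¹ ^ 2) * C (Δ α β K ^ 2) = 1 := by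
    rw [← C_mul, ← mul_pow, inv_mul_cancel₀ (Δ_pos ho K).ne', one_pow, C_1]
  rw [normPoly, mul_pow, hS.pell, ← C_pow, mul_add, h1]
  ring

/-- The zeros of the closed gaps are critical points of `P_K`. -/
lemma PellData.dvd_derivative {K : ℕ} (hS : PellData α β K S) (ho : StrictlyOrdered α β) :
    S ∣ (normPoly α β K).derivative := by
  have h := hS.normPoly_sq ho
  set p := normPoly α β K
  set H := C ((Δ α β K)⁻¹ ^ 2) * (denPoly β * numPoly α)
  -- The Bézout identity is p² - H S² = 1 itself. Differentiating it shows S ∣ 2 p p'.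
  have hcop : IsCoprime S (2 * p) := by
    refine ⟨-(H * S), C (1 / 2) * p, ?_⟩
    have h2 : (C (1 / 2) : ℝ[X]) * 2 = 1 := by
      rw [show (2 : ℝ[X]) = C 2 from rfl, ← C_mul]; norm_num
    linear_combination h + p ^ 2 * h2
  have hd := congrArg derivative h
  simp only [derivative_pow, derivative_add, derivative_one, derivative_mul, Nat.cast_ofNat,
    Nat.add_one_sub_one, pow_one] at hd
  refine hcop.dvd_of_dvd_mul_left ⟨derivative H * S + 2 * H * derivative S, ?_⟩
  simp only [C_ofNat] at hd
  linear_combination hd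

/-- On a gap |p| ≥ 1 with p = ±1 at the ends, so p keeps its sign and Rolle gives a critical point
c_j. A degree count shows that the c_j and the zeros of S are all the critical points. Enlarging
each critical point to the gap around it, or to a one-point gap if it is a zero of S, leaves bands
free of interior critical points, on which p is injective by Rolle. -/
lemma PellData.exists_gaps (hS : PellData α β (k + 1) S) (ho : StrictlyOrdered α β) :
    ∃ α' β' : Fin k → ℝ, InsertsClosedGaps α β α' β' ∧
      (∀ i, Set.BijOn (fun x => (normPoly α β (k + 1)).eval x) (band α' β' i) (Set.Icc (-1) 1)) ∧
      (∀ i, (normPoly α β (k + 1)).eval (bandLeft β' i) ^ 2 = 1 ∧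
        (normPoly α β (k + 1)).eval (bandRight α' i) ^ 2 = 1) ∧
      ∀ z : ℂ, aeval z (secondPoly α β (k + 1)) = 0 ↔ ∃ i, z = (α' i : ℂ) := by
  have hsq := hS.normPoly_sq ho
  obtain ⟨U, hU⟩ := hS.dvd_derivative ho
  have hdeg := natDegree_normPoly ho (k + 1)
  have hroots : ∀ t, t ∈ (P α β (k + 1)).roots.toFinset ↔ (normPoly α β (k + 1)).eval t = 0 := by
    intro t
    rw [Multiset.mem_toFinset, mem_roots (monic_P _).ne_zero, IsRoot, eval_normPoly,
      div_eq_zero_iff, or_iff_left (Δ_pos ho _).ne']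
  have hDN : ∀ t, 0 ≤ (denPoly β).eval t * (numPoly α).eval t →
      1 ≤ (normPoly α β (k + 1)).eval t ^ 2 := by
    intro t ht
    have h := congrArg (eval t) hsq
    simp only [eval_pow, eval_add, eval_one, eval_mul, eval_C] at h
    rw [h]
    have := mul_nonneg (mul_nonneg (sq_nonneg (Δ α β (k + 1))⁻¹) ht) (sq_nonneg (eval t S))
    linarith
  have hone : ∀ t, (denPoly β).eval t * (numPoly α).eval t * S.eval t = 0 →
      (normPoly α β (k + 1)).eval t ^ 2 = 1 := by
    intro t ht
    have h := congrArg (eval t) hsq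
    simp only [eval_pow, eval_add, eval_one, eval_mul, eval_C] at h
    rw [h]
    linear_combination (Δ α β (k + 1))⁻¹ ^ 2 * S.eval t * ht
  have hlt : ∀ t, (normPoly α β (k + 1)).eval t ^ 2 < 1 →
      (denPoly β).eval t * (numPoly α).eval t < 0 ∧ S.eval t ≠ 0 := by
    intro t ht
    refine ⟨lt_of_not_ge fun h => absurd (hDN t h) (not_le.2 ht), fun h => ?_⟩
    exact ht.ne (hone t (by rw [h, mul_zero]))
  set p := normPoly α β (k + 1) with hp
  let x : Fin (k + 1) → ℝ := fun i =>
    (P α β (k + 1)).roots.toFinset.orderEmbOfFin (card_roots_P ho (k + 1)) i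
  have hx : StrictMono x := OrderEmbedding.strictMono _
  have hx0 : ∀ i, p.eval (x i) = 0 := fun i => (hroots _).1 (Finset.orderEmbOfFin_mem _ _ _)
  obtain ⟨y, hy, hxy, hy0, hyz⟩ := exists_critical_points hdeg hx hx0
  have hyr : ∀ t, p.derivative.eval t = 0 → ∃ i, t = y i := by
    intro t ht
    obtain ⟨i, hi⟩ := hyz t ((aeval_ofReal_eq_zero _ t).2 ht)
    exact ⟨i, Complex.ofReal_inj.1 hi⟩
  have hxneg : ∀ i, (denPoly β).eval (x i) * (numPoly α).eval (x i) < 0 := fun i =>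
    (hlt _ (by rw [hx0]; norm_num)).1
  have hx1 : ∀ i, -1 < x i ∧ x i < 1 := fun i => by
    have : x i ^ 2 < 1 := lt_of_not_ge fun h =>
      absurd (ho.ordered.eval_nonneg_of_one_le_sq h) (not_le.2 (hxneg i))
    exact abs_lt.1 ((sq_lt_one_iff_abs_lt_one _).1 this)
  have hxgap : ∀ i j, x i ∉ Set.Icc (α j) (β j) := fun i j h =>
    absurd (ho.ordered.eval_nonneg_of_mem_gap h) (not_le.2 (hxneg i))
  have hendα : ∀ j, p.eval (α j) ^ 2 = 1 := fun j => hone _ (by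
    rw [eval_numPoly, Finset.prod_eq_zero (Finset.mem_univ j) (sub_self _)]; ring)
  have hendβ : ∀ j, p.eval (β j) ^ 2 = 1 := fun j => hone _ (by
    rw [eval_denPoly, Finset.prod_eq_zero (Finset.mem_univ j) (sub_self _)]; ring)
  have hendS : ∀ t, S.eval t = 0 → p.eval t ^ 2 = 1 := fun t ht => hone _ (by rw [ht, mul_zero])
  -- Two points of a closed gap with values `±1` have the same value.
  have hsame : ∀ j, ∀ s ∈ Set.Icc (α j) (β j), ∀ t ∈ Set.Icc (α j) (β j), s ≤ t →
      p.eval s ^ 2 = 1 → p.eval t ^ 2 = 1 → p.eval s = p.eval t := by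
    intro j s hs t ht hst h1 h2
    by_contra hne
    have h0 : (0 : ℝ) ∈ Set.uIcc (p.eval s) (p.eval t) := by
      rw [Set.mem_uIcc]
      rcases sq_eq_one_iff.1 h1 with h | h <;> rcases sq_eq_one_iff.1 h2 with h' | h' <;>
        rw [h, h'] at hne ⊢ <;> first | exact absurd rfl hne | norm_num
    obtain ⟨w, hw, hw0⟩ := intermediate_value_uIcc (p.continuous.continuousOn) h0
    rw [Set.uIcc_of_le hst] at hw
    have := hDN w (ho.ordered.eval_nonneg_of_mem_gap (j := j) ⟨hs.1.trans hw.1, hw.2.trans ht.2⟩)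
    simp only at hw0
    rw [hw0] at this
    norm_num at this
  have hc : ∀ j, ∃ c ∈ Set.Ioo (α j) (β j), p.derivative.eval c = 0 := fun j =>
    exists_derivative_eq_zero p (ho.2 j) (hsame j _ (Set.left_mem_Icc.2 (ho.2 j).le) _
      (Set.right_mem_Icc.2 (ho.2 j).le) (ho.2 j).le (hendα j) (hendβ j))
  choose c hc hc0 using hc
  -- Between two critical points lies a zero of p, but no zero of p lies in a gap.
  have hunique : ∀ i i' j, y i ∈ Set.Icc (α j) (β j) → y i' ∈ Set.Icc (α j) (β j) → ¬ i < i' := by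
    intro i i' j hi hi' hlt
    have h1 : x i.succ ≤ x i'.castSucc := hx.monotone hlt
    exact hxgap i.succ j ⟨hi.1.trans (hxy i).2.le, h1.trans ((hxy i').1.le.trans hi'.2)⟩
  have hcu : ∀ j, ∀ t ∈ Set.Icc (α j) (β j), p.derivative.eval t = 0 → t = c j := by
    intro j t ht ht0
    obtain ⟨i, rfl⟩ := hyr t ht0
    obtain ⟨i', hi'⟩ := hyr (c j) (hc0 j)
    have hcj : y i' ∈ Set.Icc (α j) (β j) := hi' ▸ Set.Ioo_subset_Icc_self (hc j)
    rw [hi', le_antisymm (not_lt.1 (hunique i' i j hcj ht)) (not_lt.1 (hunique i i' j ht hcj))]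
  -- At a zero of S one has p = ±1, and Rolle between α_j and c_j would produce a second critical
  -- point in the gap.
  have hSc : ∀ j, S.eval (c j) ≠ 0 := by
    intro j h
    obtain ⟨t, ht, ht0⟩ := exists_derivative_eq_zero p (hc j).1
      (hsame j _ (Set.left_mem_Icc.2 (ho.2 j).le) _ (Set.Ioo_subset_Icc_self (hc j)) (hc j).1.le
        (hendα j) (hendS _ h))
    exact ht.2.ne (hcu j t ⟨ht.1.le, ht.2.le.trans (hc j).2.le⟩ ht0)
  have hcm : StrictMono c := fun i j hij =>
    (hc i).2.trans ((ho.ordered.β_lt_α hij).trans (hc j).1)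
  have hU0 : U ≠ 0 := by
    rintro rfl
    exact derivative_ne_zero_of_natDegree hdeg (by rw [hU, mul_zero])
  -- Of the at most K - 1 zeros of p', S accounts for K - 1 - g, so the g points c_j exhaust those
  -- of U.
  have hUdeg : U.natDegree ≤ g := by
    have h1 := natDegree_derivative_le p
    rw [hU, natDegree_mul hS.monic.ne_zero hU0, hdeg] at h1
    have := hS.natDegree
    omega
  have hUc : ∀ t, U.eval t = 0 → ∃ j, t = c j := by
    intro t ht
    have := exists_mem_of_eval_eq_zero (s := Finset.univ.image c) hU0 ?_ ?_ ht
    · obtain ⟨j, -, hj⟩ := Finset.mem_image.1 this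
      exact ⟨j, hj.symm⟩
    · simp only [Finset.mem_image, Finset.mem_univ, true_and, forall_exists_index,
        forall_apply_eq_imp_iff]
      intro j
      have := hc0 j
      rw [hU, eval_mul] at this
      exact (mul_eq_zero.1 this).resolve_left (hSc j)
    · rwa [Finset.card_image_of_injective _ hcm.injective, Finset.card_univ, Fintype.card_fin]
  have hex : ∀ i, ∃ ab : ℝ × ℝ, (∃ j, y i = c j ∧ ab.1 = α j ∧ ab.2 = β j) ∨
      (S.eval (y i) = 0 ∧ ab.1 = y i ∧ ab.2 = y i) := by
    intro i
    have := hy0 i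
    rw [hU, eval_mul] at this
    rcases mul_eq_zero.1 this with h | h
    · exact ⟨(y i, y i), Or.inr ⟨h, rfl, rfl⟩⟩
    · obtain ⟨j, hj⟩ := hUc _ h
      exact ⟨(α j, β j), Or.inl ⟨j, hj, rfl, rfl⟩⟩
  choose ab hab using hex
  let α' : Fin k → ℝ := fun i => (ab i).1
  let β' : Fin k → ℝ := fun i => (ab i).2
  have hab' : ∀ i, (∃ j, y i = c j ∧ α' i = α j ∧ β' i = β j) ∨
      (S.eval (y i) = 0 ∧ α' i = y i ∧ β' i = y i) := hab
  -- A gap contains no zero of p. Having a point between two consecutive zeros, it lies between them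
  -- entirely.
  have hxα : ∀ i, x i.castSucc < α' i := by
    intro i
    rcases hab' i with ⟨j, h1, h2, h3⟩ | ⟨-, h2, -⟩
    · rw [h2]
      by_contra! h
      refine hxgap i.castSucc j ⟨h, ?_⟩
      have := (hxy i).1
      rw [h1] at this
      exact (this.trans (hc j).2).le
    · rw [h2]; exact (hxy i).1
  have hxβ : ∀ i, β' i < x i.succ := by
    intro i
    rcases hab' i with ⟨j, h1, h2, h3⟩ | ⟨-, -, h3⟩
    · rw [h3]
      by_contra! h
      refine hxgap i.succ j ⟨?_, h⟩
      have := (hxy i).2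
      rw [h1] at this
      exact ((hc j).1.trans this).le
    · rw [h3]; exact (hxy i).2
  have hord : Ordered α' β' := by
    refine ⟨fun i => (?_ : _ < x i).trans ?_, fun i => ?_⟩
    · induction i using Fin.cases with
      | zero => exact (hx1 0).1
      | succ j => exact hxβ j
    · induction i using Fin.lastCases with
      | last => rw [bandRight_last]; exact (hx1 _).2
      | cast j => rw [bandRight_castSucc]; exact hxα j
    · rcases hab' i with ⟨j, h1, h2, h3⟩ | ⟨-, h2, h3⟩
      · rw [h2, h3]; exact (ho.2 j).le
      · rw [h2, h3]
  have hι : ∀ j, ∃ i, y i = c j ∧ α' i = α j ∧ β' i = β j := by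
    intro j
    obtain ⟨i, hi⟩ := hyr (c j) (hc0 j)
    refine ⟨i, hi.symm, ?_⟩
    rcases hab' i with ⟨j', h1, h2, h3⟩ | ⟨h1, -, -⟩
    · obtain rfl : j = j' := hcm.injective (hi.trans h1)
      exact ⟨h2, h3⟩
    · exact absurd (hi ▸ h1) (hSc j)
  choose ι hιy hια hιβ using hι
  have hendL : ∀ i, p.eval (bandLeft β' i) ^ 2 = 1 := by
    intro i
    induction i using Fin.cases with
    | zero => exact hone _ (by rw [bandLeft_zero, eval_denPoly]; ring)
    | succ j =>
      rw [bandLeft_succ]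
      rcases hab' j with ⟨m, -, -, h3⟩ | ⟨h1, -, h3⟩
      · rw [h3]; exact hendβ m
      · rw [h3]; exact hendS _ h1
  have hendR : ∀ i, p.eval (bandRight α' i) ^ 2 = 1 := by
    intro i
    induction i using Fin.lastCases with
    | last => exact hone _ (by rw [bandRight_last, eval_denPoly]; ring)
    | cast j =>
      rw [bandRight_castSucc]
      rcases hab' j with ⟨m, -, h3, -⟩ | ⟨h1, h3, -⟩
      · rw [h3]; exact hendα m
      · rw [h3]; exact hendS _ h1
  have hnocrit : ∀ i, ∀ t ∈ Set.Ioo (bandLeft β' i) (bandRight α' i), p.derivative.eval t ≠ 0 := by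
    intro i t ht h0
    obtain ⟨m, rfl⟩ := hyr t h0
    have hm := hord.lt_or_gt_of_mem_Ioo ht m
    rcases hab' m with ⟨j, h1, h2, h3⟩ | ⟨-, h2, h3⟩
    · rw [h1, h2, h3] at hm
      rcases hm with h | h
      · exact absurd h (not_lt.2 (hc j).1.le)
      · exact absurd h (not_lt.2 (hc j).2.le)
    · rw [h2, h3] at hm
      simp at hm
  refine ⟨α', β', ⟨hord, ?_, ι, ?_, fun j => ⟨hια j, hιβ j⟩, ?_⟩, fun i => ?_,
    fun i => ⟨hendL i, hendR i⟩, fun z => ?_⟩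
  · rw [hord.bandSet_eq, ho.ordered.bandSet_eq]
    ext t
    refine and_congr_right fun _ => ⟨fun h j => ?_, fun h i => ?_⟩
    · have := h (ι j)
      rwa [hια, hιβ] at this
    · rcases hab' i with ⟨j, -, h2, h3⟩ | ⟨-, h2, h3⟩
      · rw [h2, h3]; exact h j
      · rw [h2, h3]; exact le_total _ _
  · intro i j hij
    have := hcm hij
    rw [← hιy i, ← hιy j] at this
    exact hy.lt_iff_lt.1 this
  · intro i hi
    rcases hab' i with ⟨j, h1, -, -⟩ | ⟨-, h2, h3⟩
    · exact absurd ⟨j, hy.injective ((hιy j).trans h1.symm)⟩ hi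
    · rw [h2, h3]
  · refine bijOn_Icc_of_injOn (hord.1 i) p.continuous.continuousOn ?_ (hendL i) (hendR i)
    have key : ∀ s ∈ band α' β' i, ∀ t ∈ band α' β' i, s < t → p.eval s ≠ p.eval t := by
      intro s hs t ht hst he
      obtain ⟨w, hw, hw0⟩ := exists_derivative_eq_zero p hst he
      exact hnocrit i w ⟨hs.1.trans_lt hw.1, hw.2.trans_le ht.2⟩ hw0
    intro s hs t ht he
    rcases lt_trichotomy s t with h | h | h
    · exact absurd he (key s hs t ht h)
    · exact h
    · exact absurd he.symm (key t ht s hs h)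
  · rw [hS.secondPoly_eq, map_mul, mul_eq_zero]
    constructor
    · rintro (h | h)
      · rw [numPoly, map_prod, Finset.prod_eq_zero_iff] at h
        obtain ⟨j, -, hj⟩ := h
        refine ⟨ι j, ?_⟩
        rw [hια]
        simpa [sub_eq_zero] using hj
      · obtain ⟨i, rfl⟩ := hyz z (by rw [hU, map_mul, h, zero_mul])
        refine ⟨i, ?_⟩
        have h0 : S.eval (y i) = 0 := (aeval_ofReal_eq_zero _ _).1 h
        rcases hab' i with ⟨j, h1, -, -⟩ | ⟨-, h2, -⟩
        · exact absurd (h1 ▸ h0) (hSc j)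
        · rw [h2]
    · rintro ⟨i, rfl⟩
      rcases hab' i with ⟨j, -, h2, -⟩ | ⟨h1, h2, -⟩
      · left
        refine (aeval_ofReal_eq_zero _ _).2 ?_
        rw [h2, eval_numPoly, Finset.prod_eq_zero (Finset.mem_univ j) (sub_self _)]
      · right
        rw [h2]
        exact (aeval_ofReal_eq_zero _ _).2 h1

end Gaps

/-! ### Zeros of the Chebyshev polynomials and their interlacing -/

section Chebyshev

open Real

lemma cos_lt_cos_iff_of_mem {s t : ℝ} (hs : s ∈ Set.Icc 0 π) (ht : t ∈ Set.Icc 0 π) :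
    cos s < cos t ↔ t < s :=
  strictAntiOn_cos.lt_iff_gt hs ht

/-- The zeros of `T_n`. -/
noncomputable def zerosT (n : ℕ) : Finset ℝ :=
  (Finset.range n).image fun k : ℕ => cos ((2 * k + 1) * π / (2 * n))

/-- The zeros of `U_n`. -/
noncomputable def zerosU (n : ℕ) : Finset ℝ :=
  (Finset.range n).image fun k : ℕ => cos ((k + 1) * π / (n + 1))

lemma mem_zerosT (n : ℕ) (x : ℝ) : x ∈ zerosT n ↔ (Chebyshev.T ℝ n).eval x = 0 := by
  rw [← IsRoot, ← mem_roots (Chebyshev.T_ne_zero ℝ n), Chebyshev.roots_T_real]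
  rfl

lemma mem_zerosU (n : ℕ) (x : ℝ) : x ∈ zerosU n ↔ (Chebyshev.U ℝ n).eval x = 0 := by
  rw [← IsRoot, ← mem_roots (Chebyshev.U_ne_zero ℝ n (by omega)), Chebyshev.roots_U_real]
  rfl

lemma card_zerosT (n : ℕ) : (zerosT n).card = n := by
  rw [zerosT, Finset.card_image_of_injOn, Finset.card_range]
  exact (Finset.range n).nodup_map_iff_injOn.1 (Chebyshev.roots_T_real_nodup n)

lemma card_zerosU (n : ℕ) : (zerosU n).card = n := by
  rw [zerosU, Finset.card_image_of_injOn, Finset.card_range]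
  exact (Finset.range n).nodup_map_iff_injOn.1 (Chebyshev.roots_U_real_nodup n)

lemma angleT_mem {n k : ℕ} (hk : k < n) : (2 * k + 1) * π / (2 * n) ∈ Set.Ioo 0 π := by
  have hn : (0 : ℝ) < n := by exact_mod_cast (by omega : 0 < n)
  have hk' : (k : ℝ) + 1 ≤ n := by exact_mod_cast hk
  refine ⟨by positivity, ?_⟩
  rw [div_lt_iff₀ (by positivity)]
  nlinarith [pi_pos]

lemma angleU_mem {n k : ℕ} (hk : k < n) : (k + 1) * π / (n + 1) ∈ Set.Ioo 0 π := by
  have hk' : (k : ℝ) + 1 ≤ n := by exact_mod_cast hk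
  refine ⟨by positivity, ?_⟩
  rw [div_lt_iff₀ (by positivity)]
  nlinarith [pi_pos]

lemma cos_mem_Ioo {t : ℝ} (ht : t ∈ Set.Ioo 0 π) : cos t ∈ Set.Ioo (-1) 1 := by
  constructor
  · rw [← cos_pi, cos_lt_cos_iff_of_mem ⟨pi_pos.le, le_rfl⟩ (Set.Ioo_subset_Icc_self ht)]
    exact ht.2
  · rw [← cos_zero, cos_lt_cos_iff_of_mem (Set.Ioo_subset_Icc_self ht) ⟨le_rfl, pi_pos.le⟩]
    exact ht.1

lemma zerosT_subset {n : ℕ} {x : ℝ} (hx : x ∈ zerosT n) : x ∈ Set.Ioo (-1) 1 := by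
  obtain ⟨k, hk, rfl⟩ := Finset.mem_image.1 hx
  exact cos_mem_Ioo (angleT_mem (Finset.mem_range.1 hk))

lemma zerosU_subset {n : ℕ} {x : ℝ} (hx : x ∈ zerosU n) : x ∈ Set.Ioo (-1) 1 := by
  obtain ⟨k, hk, rfl⟩ := Finset.mem_image.1 hx
  exact cos_mem_Ioo (angleU_mem (Finset.mem_range.1 hk))

/-- In units of π/(n + 1), the angles are the half-integers k + 1/2 for T_{n+1} and the integers k +
1 for U_n. Cosine merely reverses the order. -/
lemma interlace_zeros (n : ℕ) : Interlace (zerosT (n + 1) : Set ℝ) (zerosU n : Set ℝ) := by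
  have hn : (0 : ℝ) < n + 1 := by positivity
  have hT : ∀ {k : ℕ}, k < n + 1 → (2 * k + 1) * π / (2 * (n + 1)) ∈ Set.Icc 0 π := fun {k} hk => by
    have := Set.Ioo_subset_Icc_self (angleT_mem hk)
    rwa [Nat.cast_add_one] at this
  have hU : ∀ {k : ℕ}, k < n → (k + 1) * π / (n + 1) ∈ Set.Icc 0 π := fun hk =>
    Set.Ioo_subset_Icc_self (angleU_mem hk)
  have eT : ∀ k : ℕ, (2 * k + 1) * π / (2 * (n + 1)) = (k + 1 / 2) * (π / (n + 1)) := fun k => by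
    field_simp
  have eU : ∀ k : ℕ, (k + 1) * π / (n + 1) = (k + 1) * (π / (n + 1)) := fun k => by
    field_simp
  have hpos : 0 < π / (n + 1) := by positivity
  simp only [Interlace, zerosT, zerosU, Finset.coe_image, Finset.coe_range, Set.forall_mem_image,
    Set.exists_mem_image, Set.mem_Iio, Nat.cast_add_one]
  constructor
  · intro a ha b hb hab
    rw [cos_lt_cos_iff_of_mem (hT ha) (hT hb), eT, eT, mul_lt_mul_iff_left₀ hpos] at hab
    have hba : b < a := by
      have : (b : ℝ) < a := by linarith
      exact_mod_cast this
    have hba' : (b : ℝ) + 1 ≤ a := by exact_mod_cast hba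
    have hbn : b < n := by omega
    refine ⟨b, hbn, ?_, ?_⟩
    · rw [cos_lt_cos_iff_of_mem (hT ha) (hU hbn), eT, eU, mul_lt_mul_iff_left₀ hpos]; linarith
    · rw [cos_lt_cos_iff_of_mem (hU hbn) (hT hb), eT, eU, mul_lt_mul_iff_left₀ hpos]; linarith
  · intro a ha b hb hab
    rw [cos_lt_cos_iff_of_mem (hU ha) (hU hb), eU, eU, mul_lt_mul_iff_left₀ hpos] at hab
    have hba : b < a := by
      have : (b : ℝ) < a := by linarith
      exact_mod_cast this
    have hba' : (b : ℝ) + 1 ≤ a := by exact_mod_cast hba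
    have hbn : b + 1 < n + 1 := by omega
    refine ⟨b + 1, hbn, ?_, ?_⟩
    · rw [cos_lt_cos_iff_of_mem (hU ha) (hT hbn), eT, eU, mul_lt_mul_iff_left₀ hpos]
      push_cast; linarith
    · rw [cos_lt_cos_iff_of_mem (hT hbn) (hU hb), eT, eU, mul_lt_mul_iff_left₀ hpos]
      push_cast; linarith

/-- Interlacing is symmetric under reversal of order, so it does not matter on which bands p
increases. -/
lemma Interlace.preimage {A B s : Set ℝ} (h : Interlace A B) {f : ℝ → ℝ}
    (hf : StrictMonoOn f s ∨ StrictAntiOn f s) (hA : A ⊆ f '' s) (hB : B ⊆ f '' s) :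
    Interlace {x ∈ s | f x ∈ A} {x ∈ s | f x ∈ B} := by
  have key : ∀ C D : Set ℝ, (∀ x ∈ C, ∀ x' ∈ C, x < x' → ∃ y ∈ D, x < y ∧ y < x') → D ⊆ f '' s →
      ∀ x ∈ {x ∈ s | f x ∈ C}, ∀ x' ∈ {x ∈ s | f x ∈ C}, x < x' →
        ∃ y ∈ {x ∈ s | f x ∈ D}, x < y ∧ y < x' := by
    intro C D hCD hD x hx x' hx' hxx
    rcases hf with hf | hf
    · obtain ⟨_, hy, h1, h2⟩ := hCD _ hx.2 _ hx'.2 (hf hx.1 hx'.1 hxx)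
      obtain ⟨y, hys, rfl⟩ := hD hy
      exact ⟨y, ⟨hys, hy⟩, (hf.lt_iff_lt hx.1 hys).1 h1, (hf.lt_iff_lt hys hx'.1).1 h2⟩
    · obtain ⟨_, hy, h1, h2⟩ := hCD _ hx'.2 _ hx.2 (hf hx.1 hx'.1 hxx)
      obtain ⟨y, hys, rfl⟩ := hD hy
      exact ⟨y, ⟨hys, hy⟩, (hf.lt_iff_gt hys hx.1).1 h2, (hf.lt_iff_gt hx'.1 hys).1 h1⟩
  exact ⟨key A B h.1 hB, key B A h.2 hA⟩

end Chebyshev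

/-! ### Pulling zeros back along a polynomial that maps each band onto [-1, 1] -/

section Pullback

variable {k : ℕ} {α β : Fin k → ℝ} {p : ℝ[X]}

/-- A polynomial that maps every band bijectively onto `[-1, 1]`. -/
structure MapsBands (α β : Fin k → ℝ) (p : ℝ[X]) : Prop where
  ordered : Ordered α β
  natDegree : p.natDegree = k + 1
  bijOn : ∀ i, Set.BijOn (fun x => p.eval x) (band α β i) (Set.Icc (-1) 1)
  left : ∀ i, p.eval (bandLeft β i) ^ 2 = 1
  right : ∀ i, p.eval (bandRight α i) ^ 2 = 1

lemma MapsBands.mem_Ioo (hp : MapsBands α β p) {i : Fin (k + 1)} {x : ℝ} (hx : x ∈ band α β i)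
    (hpx : p.eval x ∈ Set.Ioo (-1) 1) : x ∈ Set.Ioo (bandLeft β i) (bandRight α i) := by
  have hne : p.eval x ^ 2 ≠ 1 := by nlinarith [hpx.1, hpx.2]
  refine ⟨hx.1.lt_of_ne ?_, hx.2.lt_of_ne ?_⟩
  · rintro rfl; exact hne (hp.left i)
  · rintro rfl; exact hne (hp.right i)

lemma MapsBands.strictMonoOn_or (hp : MapsBands α β p) (i : Fin (k + 1)) :
    StrictMonoOn (fun x => p.eval x) (band α β i) ∨ StrictAntiOn (fun x => p.eval x) (band α β i) :=
  p.continuous.continuousOn.strictMonoOn_of_injOn_Icc' (hp.ordered.1 i).le (hp.bijOn i).injOn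

lemma MapsBands.encard_preimage (hp : MapsBands α β p) (i : Fin (k + 1)) {R : Finset ℝ}
    (hR : ∀ c ∈ R, c ∈ Set.Ioo (-1 : ℝ) 1) :
    {x ∈ band α β i | p.eval x ∈ R}.encard = R.card := by
  have himg : (fun x => p.eval x) '' {x ∈ band α β i | p.eval x ∈ R} = (R : Set ℝ) := by
    ext c
    constructor
    · rintro ⟨x, hx, rfl⟩; exact hx.2
    · intro hc
      obtain ⟨x, hx, rfl⟩ := (hp.bijOn i).surjOn (Set.Ioo_subset_Icc_self (hR c hc))
      exact ⟨x, ⟨hx, hc⟩, rfl⟩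
  rw [← Set.encard_coe_eq_coe_finsetCard, ← himg,
    ((hp.bijOn i).injOn.mono fun x hx => hx.1).encard_image]

/-- If all zeros of `f` are simple and lie in `(-1, 1)`, the zeros of `f ∘ p` are simple and lie in
the interiors of the bands. -/
lemma MapsBands.exists_zeros (hp : MapsBands α β p) {f : ℝ[X]} (hf : f ≠ 0) {R : Finset ℝ}
    (hR : ∀ c ∈ R, c ∈ Set.Ioo (-1 : ℝ) 1) (hR0 : ∀ c ∈ R, f.eval c = 0)
    (hcard : R.card = f.natDegree) :
    ∃ s : Finset ℝ, s.card = (f.comp p).natDegree ∧ f.comp p ≠ 0 ∧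
      (∀ x ∈ s, (f.comp p).eval x = 0) ∧
      ∀ x ∈ s, ∃ i, x ∈ Set.Ioo (bandLeft β i) (bandRight α i) := by
  have hex : ∀ (i : Fin (k + 1)) (c : ℝ), ∃ x, c ∈ R →
      x ∈ Set.Ioo (bandLeft β i) (bandRight α i) ∧ p.eval x = c := by
    intro i c
    by_cases hc : c ∈ R
    · obtain ⟨x, hx, rfl⟩ := (hp.bijOn i).surjOn (Set.Ioo_subset_Icc_self (hR c hc))
      exact ⟨x, fun _ => ⟨hp.mem_Ioo hx (hR _ hc), rfl⟩⟩
    · exact ⟨0, fun h => absurd h hc⟩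
  choose x hx using hex
  -- One preimage per zero and band: (k + 1) deg f points, distinct because open bands are disjoint,
  -- which is the degree of f ∘ p.
  refine ⟨(Finset.univ ×ˢ R).image fun ic => x ic.1 ic.2, ?_, ?_, ?_, ?_⟩
  · rw [Finset.card_image_of_injOn, Finset.card_product, Finset.card_univ, Fintype.card_fin,
      natDegree_comp, hp.natDegree, hcard, mul_comm]
    rintro ⟨i, c⟩ hic ⟨j, d⟩ hjd h
    simp only [Finset.coe_product, Finset.coe_univ, Set.mem_prod, Set.mem_univ, true_and,
      Finset.mem_coe] at hic hjd h
    obtain ⟨hi, hci⟩ := hx i c hic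
    obtain ⟨hj, hdj⟩ := hx j d hjd
    have hcd : c = d := by rw [← hci, ← hdj, h]
    have hij : i = j := by
      rw [h] at hi
      rcases lt_trichotomy i j with hl | hl | hl
      · exact absurd (hi.2.trans_le (hp.ordered.right_le_left hl)) (not_lt.2 hj.1.le)
      · exact hl
      · exact absurd (hj.2.trans_le (hp.ordered.right_le_left hl)) (not_lt.2 hi.1.le)
    rw [hcd, hij]
  · intro h
    rcases comp_eq_zero_iff.1 h with h | ⟨-, h⟩
    · exact hf h
    · have := hp.natDegree
      rw [h, natDegree_C] at this
      omega
  · simp only [Finset.mem_image, Finset.mem_product, Finset.mem_univ, true_and]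
    rintro _ ⟨⟨i, c⟩, hc, rfl⟩
    rw [eval_comp, (hx i c hc).2, hR0 c hc]
  · simp only [Finset.mem_image, Finset.mem_product, Finset.mem_univ, true_and]
    rintro _ ⟨⟨i, c⟩, hc, rfl⟩
    exact ⟨i, (hx i c hc).1⟩

lemma MapsBands.exists_mem_of_aeval_comp (hp : MapsBands α β p) {f : ℝ[X]} (hf : f ≠ 0)
    {R : Finset ℝ} (hR : ∀ c ∈ R, c ∈ Set.Ioo (-1 : ℝ) 1) (hR0 : ∀ c ∈ R, f.eval c = 0)
    (hcard : R.card = f.natDegree) {z : ℂ} (hz : aeval z (f.comp p) = 0) :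
    ∃ i, ∃ x ∈ Set.Ioo (bandLeft β i) (bandRight α i), z = (x : ℂ) := by
  obtain ⟨s, hs, h0, hs0, hsb⟩ := hp.exists_zeros hf hR hR0 hcard
  obtain ⟨x, hx, rfl⟩ := exists_mem_of_aeval_eq_zero h0 hs0 hs.ge hz
  obtain ⟨i, hi⟩ := hsb x hx
  exact ⟨i, x, hi, rfl⟩

lemma MapsBands.nodup_roots_comp (hp : MapsBands α β p) {f : ℝ[X]} (hf : f ≠ 0)
    {R : Finset ℝ} (hR : ∀ c ∈ R, c ∈ Set.Ioo (-1 : ℝ) 1) (hR0 : ∀ c ∈ R, f.eval c = 0)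
    (hcard : R.card = f.natDegree) : (f.comp p).roots.Nodup := by
  obtain ⟨s, hs, h0, hs0, -⟩ := hp.exists_zeros hf hR hR0 hcard
  have hle : s.val ≤ (f.comp p).roots := by
    rw [Multiset.le_iff_subset s.nodup]
    exact fun x hx => (mem_roots h0).2 (hs0 x hx)
  rw [← Multiset.eq_of_le_of_card_le hle ((card_roots' _).trans hs.ge)]
  exact s.nodup

end Pullback

end GenCheb

/-! ### The theorem -/

theorem theorem4p2 {g : ℕ} (α β : Fin g → ℝ) (hαβ : StrictlyOrdered α β)
    (K : ℕ) (hK : 1 ≤ K) (hper : HasPeriod α β K) :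
    -- the `K` subintervals that make up `E`, each mapped bijectively onto `[-1, 1]`
    ∃ α' β' : Fin (K - 1) → ℝ, InsertsClosedGaps α β α' β' ∧
      (∀ i, Set.BijOn (fun x => (P α β K).eval x / Δ α β K) (band α' β' i) (Set.Icc (-1) 1)) ∧
      -- the polynomials of the first kind
      (∀ n : ℕ,
        P α β (n * K) =
          C (Δ α β K ^ n) * (monicT n).comp (C (Δ α β K)⁻¹ * P α β K) ∧
        (∀ z : ℂ, aeval z (P α β (n * K)) = 0 → ∃ x ∈ bandSet α β, z = (x : ℂ)) ∧
        (P α β (n * K)).roots.Nodup ∧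
        ∀ i,
          {x ∈ band α' β' i | (P α β (n * K)).eval x = 0}.encard = n ∧
          {x ∈ band α' β' i | (P α β (n * K)).eval x = 0} ⊆ interior (band α' β' i)) ∧
      -- the polynomials of the second kind
      (∀ n : ℕ, 1 ≤ n →
        (∀ j, Q α β (n * K) (α' j : ℂ) = 0) ∧
        (∀ z : ℂ, Q α β (n * K) z = 0 →
          (∃ j, z = (α' j : ℂ)) ∨ ∃ i, ∃ x ∈ interior (band α' β' i), z = (x : ℂ)) ∧
        ∀ i,
          {x ∈ interior (band α' β' i) | Q α β (n * K) (x : ℂ) = 0}.encard = ((n - 1 : ℕ) : ℕ∞) ∧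
          Interlace {x ∈ band α' β' i | (P α β (n * K)).eval x = 0}
            {x ∈ interior (band α' β' i) | Q α β (n * K) (x : ℂ) = 0}) := by
  obtain ⟨k, rfl⟩ : ∃ k, K = k + 1 := Nat.exists_eq_add_one.2 hK
  obtain ⟨S, hS⟩ := hper.exists_pellData hαβ hK
  obtain ⟨α', β', hins, hbij, hends, hQK⟩ := hS.exists_gaps hαβ
  set p := normPoly α β (k + 1) with hp
  have hmaps : MapsBands α' β' p :=
    ⟨hins.1, natDegree_normPoly hαβ _, hbij, fun i => (hends i).1, fun i => (hends i).2⟩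
  have hΔ := Δ_pos hαβ (k + 1)
  have hint : ∀ i, interior (band α' β' i) = Set.Ioo (bandLeft β' i) (bandRight α' i) :=
    fun i => interior_Icc
  -- zeros of the polynomials of the first kind in terms of `p`
  have hPn : ∀ n : ℕ, ∃ c : ℝ, c ≠ 0 ∧
      P α β (n * (k + 1)) = C c * (Chebyshev.T ℝ n).comp p := by
    intro n
    refine ⟨Δ α β (k + 1) ^ n * ((2 : ℝ) ^ (n - 1))⁻¹, by positivity, ?_⟩
    rw [hS.P_mul hαβ hper n, monicT, mul_comp, C_comp, C_mul, mul_assoc]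
  have hPzero : ∀ (n : ℕ) (x : ℝ), (P α β (n * (k + 1))).eval x = 0 ↔ p.eval x ∈ zerosT n := by
    intro n x
    obtain ⟨c, hc, h⟩ := hPn n
    rw [h, eval_mul, eval_C, mul_eq_zero, or_iff_right hc, eval_comp, mem_zerosT]
  have hTdeg : ∀ n : ℕ, (zerosT n).card = (Chebyshev.T ℝ n).natDegree := fun n => by
    rw [card_zerosT]; simp
  have hUdeg : ∀ n : ℕ, (zerosU n).card = (Chebyshev.U ℝ n).natDegree := fun n => by
    rw [card_zerosU, Chebyshev.natDegree_U_natCast]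
  have hsetP : ∀ (n : ℕ) i, {x ∈ band α' β' i | (P α β (n * (k + 1))).eval x = 0} =
      {x ∈ band α' β' i | p.eval x ∈ zerosT n} := fun n i => by
    ext x; exact and_congr_right fun _ => hPzero n x
  -- zeros of the polynomials of the second kind in terms of `p`
  have hQn : ∀ n : ℕ, ∃ c : ℝ, c ≠ 0 ∧ secondPoly α β ((n + 1) * (k + 1)) =
      C c * secondPoly α β (k + 1) * (Chebyshev.U ℝ n).comp p := fun n =>
    ⟨Δ α β (k + 1) ^ n * ((2 : ℝ) ^ n)⁻¹, by positivity, (hS.chebyshev hαβ hper n).2⟩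
  have hQzero : ∀ (n : ℕ) (z : ℂ), Q α β ((n + 1) * (k + 1)) z = 0 ↔
      (∃ j, z = (α' j : ℂ)) ∨ aeval z ((Chebyshev.U ℝ n).comp p) = 0 := by
    intro n z
    obtain ⟨c, hc, h⟩ := hQn n
    rw [Q_eq_aeval hαβ, h, map_mul, map_mul, mul_eq_zero, mul_eq_zero, hQK, aeval_C,
      or_iff_right (show algebraMap ℝ ℂ c ≠ 0 by simpa using hc)]
  have hsetQ : ∀ (n : ℕ) i, {x ∈ interior (band α' β' i) | Q α β ((n + 1) * (k + 1)) (x : ℂ) = 0} =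
      {x ∈ band α' β' i | p.eval x ∈ zerosU n} := by
    intro n i
    ext x
    have hreal : aeval (x : ℂ) ((Chebyshev.U ℝ n).comp p) = 0 ↔ p.eval x ∈ zerosU n := by
      rw [mem_zerosU, aeval_ofReal_eq_zero, eval_comp]
    constructor
    · rintro ⟨hx, h0⟩
      refine ⟨interior_subset hx, ?_⟩
      -- The zeros α'_j of Q_K lie in no open band, so inside a band only the factor U_n(p) counts.
      rcases (hQzero n x).1 h0 with ⟨j, hj⟩ | h
      · rw [hint] at hx
        have hj' := Complex.ofReal_inj.1 hj
        rcases hmaps.ordered.lt_or_gt_of_mem_Ioo hx j with h | h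
        · exact absurd hj' h.ne
        · exact absurd hj' ((hmaps.ordered.2 j).trans_lt h).ne'
      · exact hreal.1 h
    · rintro ⟨hx, h0⟩
      refine ⟨?_, (hQzero n x).2 (Or.inr (hreal.2 h0))⟩
      rw [hint]
      exact hmaps.mem_Ioo hx (zerosU_subset h0)
  refine ⟨α', β', hins, fun i => ?_, fun n => ⟨hS.P_mul hαβ hper n, fun z hz => ?_, ?_, fun i => ?_⟩,
    fun n hn => ?_⟩
  · simpa only [hp, eval_normPoly] using hbij i
  · obtain ⟨c, hc, h⟩ := hPn n
    rw [h, map_mul, aeval_C, mul_eq_zero,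
      or_iff_right (show algebraMap ℝ ℂ c ≠ 0 by simpa using hc)] at hz
    obtain ⟨i, x, hx, rfl⟩ := hmaps.exists_mem_of_aeval_comp (Chebyshev.T_ne_zero ℝ n)
      (fun c hc => zerosT_subset hc) (fun c hc => (mem_zerosT n c).1 hc) (hTdeg n) hz
    refine ⟨x, ?_, rfl⟩
    rw [← hins.2.1]
    exact Set.mem_iUnion.2 ⟨i, Set.Ioo_subset_Icc_self hx⟩
  · obtain ⟨c, hc, h⟩ := hPn n
    rw [h, roots_C_mul _ hc]
    exact hmaps.nodup_roots_comp (Chebyshev.T_ne_zero ℝ n)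
      (fun c hc => zerosT_subset hc) (fun c hc => (mem_zerosT n c).1 hc) (hTdeg n)
  · rw [hsetP]
    refine ⟨?_, fun x hx => ?_⟩
    · rw [hmaps.encard_preimage i fun c hc => zerosT_subset hc, card_zerosT]
    · exact (hint i).symm ▸ hmaps.mem_Ioo hx.1 (zerosT_subset hx.2)
  -- After this substitution T_{n+1} belongs to the first kind and U_n, with n zeros per band, to
  -- the second.
  · obtain ⟨n, rfl⟩ : ∃ m, n = m + 1 := Nat.exists_eq_add_one.2 hn
    refine ⟨fun j => (hQzero n _).2 (Or.inl ⟨j, rfl⟩), fun z hz => ?_, fun i => ?_⟩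
    · refine ((hQzero n z).1 hz).imp_right fun h => ?_
      obtain ⟨i, x, hx, rfl⟩ := hmaps.exists_mem_of_aeval_comp
        (Chebyshev.U_ne_zero ℝ n (by omega))
        (fun c hc => zerosU_subset hc) (fun c hc => (mem_zerosU n c).1 hc) (hUdeg n) h
      exact ⟨i, x, (hint i).symm ▸ hx, rfl⟩
    · rw [hsetQ, hsetP]
      refine ⟨?_, ?_⟩
      · rw [hmaps.encard_preimage i fun c hc => zerosU_subset hc, card_zerosU, Nat.add_sub_cancel]
      · refine (interlace_zeros n).preimage (hmaps.strictMonoOn_or i) ?_ ?_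
        · rw [(hmaps.bijOn i).image_eq]
          exact fun c hc => Set.Ioo_subset_Icc_self (zerosT_subset hc)
        · rw [(hmaps.bijOn i).image_eq]
          exact fun c hc => Set.Ioo_subset_Icc_self (zerosU_subset hc)
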